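/- Let $(M,g)$ be a closed Riemannian manifold of real dimension $n$ with a smooth $g$-orthogonal almost complex structure $J$ (for instance a closed Kähler manifold $(M,g,J)$). Let $G$ be the complex-hyperbolic curvature tensor on $TM$, with curvature endomorphisms $$4G(X,Y)=X\wedge Y+JX\wedge JY-2\langle X,JY\rangle J,\qquad (X\wedge Y)Z:=\langle X,Z\rangle Y-\langle Y,Z\rangle X .$$ For $E=TM$ put $G_E(X,Y,\omega,\eta)=\langle G(X,Y)\omega,\eta\rangle$. For $E=S^2TM$, the bundle of symmetric endomorphisms of $TM$ with scalar product $\langle A,B\rangle=\mathrm{Tr}(A^\top B)$, put $G_E(X,Y,\omega,\eta)=\langle [G(X,Y),\omega],\eta\rangle$. Let $SM\to M$ be the unit tangent bundle, let $\Omega_k\to M$ be the bundle whose fibre at $x$ is the space of spherical harmonics of degree $k$ on the unit sphere $S_xM\subset T_xM$ (so $\Omega_{-1}=0$), and view sections $f\in C^\infty(M,\Omega_k\otimes E)$ as sections over $SM$ of the pullback of $E$. Write pointwise $f=\sum_\alpha f_\alpha \mathbf e_\alpha$ with $(\mathbf e_\alpha)$ an orthonormal basis of $E_x$, let $\nabla_{\mathbb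 V}f_\alpha$ be the gradient of $f_\alpha$ on the round sphere $S_xM$, and set $$\langle \mathcal G^Ef,\nabla^E_{\mathbb V}f\rangle_{L^2}:=\int_M\int_{S_xM}\sum_\alpha G_E(v,\nabla_{\mathbb V}f_\alpha,f,\mathbf e_\alpha)\,|dv|\,|dx| ,\qquad \|f\|_{L^2}^2:=\int_M\int_{S_xM}|f(v)|^2\,|dv|\,|dx|,$$ where $|dv|$ is the round measure on $S_xM$ and $|dx|$ the Riemannian measure. For $w=v$ or $w=Jv$ let $\iota_wf=\langle w,f(v)\rangle$ if $E=TM$, and $\iota_wf=f(v)w\in T_xM$ if $E=S^2TM$. Let $k\ge 0$ and let $f\in C^\infty(M,\Omega_k\otimes E)$ be such that $\iota_vf$ and $\iota_{Jv}f$ are (fibrewise) spherical harmonics of degree $k-1$. (i) If $E=TM$, then $$\langle \mathcal G^{TM}f,\nabla^{TM}_{\mathbb V}f\rangle_{L^2}=\tfrac14(n+2k-4)\big(\|\iota_vf\|^2_{L^2}+\|\iota_{Jv}f\|^2_{L^2}\big)+\tfrac12\|f\|^2_{L^2}+\tfrac12\int_M\int_{S_xM}\sum_\alpha\langle v,J\nabla_{\mathbb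 V}f_\alpha\rangle\langle f,J\mathbf e_\alpha\rangle\,|dv|\,|dx| .$$ (ii) If $E=S^2TM$ and $[J,f]=0$, then $$\langle \mathcal G^{S^2TM}f,\nabla^{S^2TM}_{\mathbb V}f\rangle_{L^2}=(n+2k-4)\|\iota_vf\|^2_{L^2}+\|f\|^2_{L^2}.$$ -/

import Mathlib

open MeasureTheory Metric
open scoped Manifold ContDiff Bundle InnerProductSpace

noncomputable section

/-! ### Analysis on the unit sphere of a Euclidean vector space -/

section Fibre

variable {V : Type*} [NormedAddCommGroup V] [InnerProductSpace ℝ V] [FiniteDimensional ℝ V]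

open Classical in
/-- The extension of a map on the unit sphere of `V` to a map on `V ∖ {0}` which is constant along
rays (with the irrelevant value `0` at the origin). -/
def radialExt {W : Type*} [Zero W] (f : sphere (0 : V) 1 → W) (w : V) : W :=
  if hw : w = 0 then 0
  else f ⟨‖w‖⁻¹ • w, by simp [norm_smul, hw]⟩

/-- The gradient at `v` of a function on the unit sphere, for the round metric. It is the Euclidean
gradient of the extension which is constant along rays; it is tangent to the sphere. -/
def sphereGrad (φ : sphere (0 : V) 1 → ℝ) (v : sphere (0 : V) 1) : V :=
  haveI : CompleteSpace V := FiniteDimensional.complete ℝ V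
  gradient (radialExt φ) (v : V)

/-- The integral over the unit sphere for the round surface measure. -/
def sphereIntegral (F : sphere (0 : V) 1 → ℝ) : ℝ :=
  letI : MeasurableSpace V := borel V
  haveI : BorelSpace V := ⟨rfl⟩
  ∫ v, F v ∂((volume : Measure V).toSphere)

/-- `f` is a (vector valued) spherical harmonic of degree `d`: the restriction to the unit sphere
of a harmonic homogeneous polynomial of degree `d` on `V`. The maps on `V` that are smooth
(also at the origin) and homogeneous of degree `d` are exactly the homogeneous polynomial maps of
degree `d`; for `d < 0` only the zero map is one. -/
def IsSphericalHarmonic {W : Type*} [NormedAddCommGroup W] [NormedSpace ℝ W]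
    (d : ℤ) (f : sphere (0 : V) 1 → W) : Prop :=
  ∃ P : V → W, ContDiff ℝ ∞ P ∧ (∀ t : ℝ, 0 < t → ∀ v : V, P (t • v) = t ^ d • P v) ∧
    (∀ v : V, Laplacian.laplacian P v = 0) ∧ ∀ v : sphere (0 : V) 1, P (v : V) = f v

/-! ### The curvature tensor of complex hyperbolic space -/

/-- `X ∧ Y` as the skew-symmetric endomorphism `Z ↦ ⟨X, Z⟩ Y - ⟨Y, Z⟩ X`. -/
def wedgeEnd (X Y : V) : V →ₗ[ℝ] V :=
  (innerₛₗ ℝ X).smulRight Y - (innerₛₗ ℝ Y).smulRight X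

/-- The curvature endomorphism `G(X, Y)` of complex hyperbolic space of holomorphic sectional
curvature `-1`: `4 G(X, Y) = X ∧ Y + JX ∧ JY - 2 ⟨X, JY⟩ J`. -/
def hypCurv (J : V →ₗ[ℝ] V) (X Y : V) : V →ₗ[ℝ] V :=
  (1 / 4 : ℝ) • (wedgeEnd X Y + wedgeEnd (J X) (J Y) - (2 * ⟪X, J Y⟫_ℝ) • J)

/-! ### Symmetric endomorphisms with the trace scalar product -/

/-- The trace scalar product `⟨A, B⟩ = Tr (Aᵀ B)` on endomorphisms. -/
def traceInner (A B : V →ₗ[ℝ] V) : ℝ := LinearMap.trace ℝ V (A.adjoint ∘ₗ B)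

variable (V) in
/-- `S²V`, identified with the space of symmetric endomorphisms of `V`. -/
def symEnd : Submodule ℝ (V →ₗ[ℝ] V) where
  carrier := {A | A.IsSymmetric}
  add_mem' := fun hA hB => LinearMap.IsSymmetric.add hA hB
  zero_mem' := LinearMap.IsSymmetric.zero
  smul_mem' := fun c _ hA => LinearMap.IsSymmetric.smul (by simp) hA

/-- The trace scalar product on `S²V`. -/
instance symEndCore : InnerProductSpace.Core ℝ (symEnd V) where
  inner A B := traceInner (A : V →ₗ[ℝ] V) (B : V →ₗ[ℝ] V)
  conj_inner_symm A B := by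
    have h : ((B : V →ₗ[ℝ] V).adjoint ∘ₗ (A : V →ₗ[ℝ] V)) =
        ((A : V →ₗ[ℝ] V).adjoint ∘ₗ (B : V →ₗ[ℝ] V)).adjoint := by
      rw [LinearMap.adjoint_comp, LinearMap.adjoint_adjoint]
    simp only [traceInner, h, conj_trivial]
    rw [LinearMap.trace_eq_sum_inner _ (stdOrthonormalBasis ℝ V),
      LinearMap.trace_eq_sum_inner _ (stdOrthonormalBasis ℝ V)]
    refine Finset.sum_congr rfl fun i _ => ?_
    rw [LinearMap.adjoint_inner_right, real_inner_comm]
  re_inner_nonneg A := by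
    simp only [traceInner, LinearMap.trace_eq_sum_inner _ (stdOrthonormalBasis ℝ V),
      LinearMap.comp_apply, LinearMap.adjoint_inner_right]
    have h0 : ∀ i ∈ Finset.univ, 0 ≤ ⟪(A : V →ₗ[ℝ] V) (stdOrthonormalBasis ℝ V i),
        (A : V →ₗ[ℝ] V) (stdOrthonormalBasis ℝ V i)⟫_ℝ := fun i _ => real_inner_self_nonneg
    exact Finset.sum_nonneg h0
  add_left A B C := by
    simp [traceInner, LinearMap.add_comp]
  smul_left A B c := by
    simp [traceInner, LinearMap.smul_comp]
  definite A h := by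
    simp only [traceInner, LinearMap.trace_eq_sum_inner _ (stdOrthonormalBasis ℝ V),
      LinearMap.comp_apply, LinearMap.adjoint_inner_right] at h
    have h0 : ∀ i ∈ Finset.univ, 0 ≤ ⟪(A : V →ₗ[ℝ] V) (stdOrthonormalBasis ℝ V i),
        (A : V →ₗ[ℝ] V) (stdOrthonormalBasis ℝ V i)⟫_ℝ := fun i _ => real_inner_self_nonneg
    rw [Finset.sum_eq_zero_iff_of_nonneg h0] at h
    refine Subtype.ext ((stdOrthonormalBasis ℝ V).toBasis.ext fun i => ?_)
    simpa using h i (Finset.mem_univ i)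

instance : NormedAddCommGroup (symEnd V) := symEndCore.toNormedAddCommGroup

instance : InnerProductSpace ℝ (symEnd V) := InnerProductSpace.ofCore symEndCore.toCore

/-! ### The fibrewise integrand of the curvature term -/

/-- `∑_α R_E(v, ∇ f_α, f, e_α)` at the point `v` of the unit sphere of `V`, where `f` takes values in
the Euclidean space `W`, `(e_α)` is an orthonormal basis of `W`, `f = ∑_α f_α e_α`, and `R_E` is a
tensor on `V × V × W × W`. For multilinear `R_E` the choice of the orthonormal basis is
irrelevant. -/
def curvPairing {W : Type*} [NormedAddCommGroup W] [InnerProductSpace ℝ W] [FiniteDimensional ℝ W]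
    (RE : V → V → W → W → ℝ) (f : sphere (0 : V) 1 → W) (v : sphere (0 : V) 1) : ℝ :=
  ∑ α, RE v (sphereGrad (fun w => ⟪f w, stdOrthonormalBasis ℝ W α⟫_ℝ) v) (f v)
    (stdOrthonormalBasis ℝ W α)

/-- `G_E` for `E = V`: `G(X, Y, σ, τ) = ⟨G(X, Y) σ, τ⟩`. -/
def hypTensor (J : V →ₗ[ℝ] V) (X Y σ τ : V) : ℝ := ⟪hypCurv J X Y σ, τ⟫_ℝ

/-- `G_E` for `E = S²V`: the extension of `G(X, Y)` as a derivation is `σ ↦ [G(X, Y), σ]`, so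
`G_E(X, Y, σ, τ) = ⟨[G(X, Y), σ], τ⟩` for the trace scalar product. -/
def hypTensorSym (J : V →ₗ[ℝ] V) (X Y : V) (σ τ : symEnd V) : ℝ :=
  traceInner (hypCurv J X Y ∘ₗ (σ : V →ₗ[ℝ] V) - (σ : V →ₗ[ℝ] V) ∘ₗ hypCurv J X Y)
    (τ : V →ₗ[ℝ] V)

/-- `∑_α ⟨v, J ∇ f_α⟩ ⟨f, J e_α⟩` at the point `v` of the unit sphere, with `(e_α)` an orthonormal
basis of `V` and `f = ∑_α f_α e_α`. -/
def crossTerm (J : V →ₗ[ℝ] V) (f : sphere (0 : V) 1 → V) (v : sphere (0 : V) 1) : ℝ :=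
  ∑ α, ⟪(v : V), J (sphereGrad (fun w => ⟪f w, stdOrthonormalBasis ℝ V α⟫_ℝ) v)⟫_ℝ *
    ⟪f v, J (stdOrthonormalBasis ℝ V α)⟫_ℝ

/-- `ι_v f = ⟨v, f⟩` for `f` with values in `V`. -/
def iotaV (f : sphere (0 : V) 1 → V) (v : sphere (0 : V) 1) : ℝ := ⟪(v : V), f v⟫_ℝ

/-- `ι_{Jv} f = ⟨Jv, f⟩` for `f` with values in `V`. -/
def iotaJV (J : V →ₗ[ℝ] V) (f : sphere (0 : V) 1 → V) (v : sphere (0 : V) 1) : ℝ :=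
  ⟪J (v : V), f v⟫_ℝ

/-- `ι_v f = f(v) v` for `f` with values in `S²V`. -/
def iotaVSym (f : sphere (0 : V) 1 → symEnd V) (v : sphere (0 : V) 1) : V :=
  (f v : V →ₗ[ℝ] V) (v : V)

/-- `ι_{Jv} f = f(v) (Jv)` for `f` with values in `S²V`. -/
def iotaJVSym (J : V →ₗ[ℝ] V) (f : sphere (0 : V) 1 → symEnd V) (v : sphere (0 : V) 1) : V :=
  (f v : V →ₗ[ℝ] V) (J (v : V))

end Fibre

/-! ### Riemannian manifolds -/

section Manifold

variable (n : ℕ) (M : Type*) [TopologicalSpace M] [ChartedSpace (EuclideanSpace ℝ (Fin n)) M]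

instance (x : M) : FiniteDimensional ℝ (TangentSpace (𝓡 n) x) :=
  inferInstanceAs (FiniteDimensional ℝ (EuclideanSpace ℝ (Fin n)))

variable [Bundle.RiemannianBundle (fun x : M => TangentSpace (𝓡 n) x)]

variable {M} in
/-- The Gram matrix `g_ij(y) = g(∂_i, ∂_j)` of the metric at the point with coordinates `y` in the
preferred chart at `x₀`, for the coordinate vector fields `∂_i` of this chart. -/
def chartGram (x₀ : M) (y : EuclideanSpace ℝ (Fin n)) : Matrix (Fin n) (Fin n) ℝ :=
  Matrix.of fun i j =>
    ⟪(mfderiv (𝓡 n) (𝓡 n) (chartAt (EuclideanSpace ℝ (Fin n)) x₀).symm y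
        (EuclideanSpace.single i (1 : ℝ)) :
          TangentSpace (𝓡 n) ((chartAt (EuclideanSpace ℝ (Fin n)) x₀).symm y)),
      (mfderiv (𝓡 n) (𝓡 n) (chartAt (EuclideanSpace ℝ (Fin n)) x₀).symm y
        (EuclideanSpace.single j (1 : ℝ)) :
          TangentSpace (𝓡 n) ((chartAt (EuclideanSpace ℝ (Fin n)) x₀).symm y))⟫_ℝ

variable {M} in
/-- The measure on `M` which on the domain of the preferred chart at `x₀` is the Riemannian
measure `√(det g_ij) dy`, and which vanishes outside this domain. -/
def chartMeasure [MeasurableSpace M] (x₀ : M) : Measure M :=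
  Measure.map (chartAt (EuclideanSpace ℝ (Fin n)) x₀).symm
    ((volume.restrict (chartAt (EuclideanSpace ℝ (Fin n)) x₀).target).withDensity
      fun y => ENNReal.ofReal (Real.sqrt (chartGram n x₀ y).det))

variable [IsManifold (𝓡 n) ∞ M]

/-- A smooth almost complex structure on `M` which is orthogonal for the Riemannian metric. -/
structure OrthogonalAlmostComplexStructure where
  J : ∀ x : M, TangentSpace (𝓡 n) x →L[ℝ] TangentSpace (𝓡 n) x
  smooth : ContMDiff (𝓡 n)
    ((𝓡 n).prod 𝓘(ℝ, EuclideanSpace ℝ (Fin n) →L[ℝ] EuclideanSpace ℝ (Fin n))) ∞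
    (fun x => Bundle.TotalSpace.mk' (EuclideanSpace ℝ (Fin n) →L[ℝ] EuclideanSpace ℝ (Fin n))
      (E := fun x : M => TangentSpace (𝓡 n) x →L[ℝ] TangentSpace (𝓡 n) x) x (J x))
  sq : ∀ (x : M) (v : TangentSpace (𝓡 n) x), J x (J x v) = -v
  inner_map : ∀ (x : M) (v w : TangentSpace (𝓡 n) x), ⟪J x v, J x w⟫_ℝ = ⟪v, w⟫_ℝ

variable {n M} in
/-- The almost complex structure on the tangent space at `x`, as a linear map. -/
def OrthogonalAlmostComplexStructure.lin (J : OrthogonalAlmostComplexStructure n M) (x : M) :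
    TangentSpace (𝓡 n) x →ₗ[ℝ] TangentSpace (𝓡 n) x :=
  (J.J x).toLinearMap

variable {n M} in
/-- Smoothness of a section over the unit tangent bundle `SM` of the pullback of `TM`:
its extension to the tangent bundle without the zero section, constant along rays, is smooth. -/
def IsSmoothOnSM (f : ∀ x : M, sphere (0 : TangentSpace (𝓡 n) x) 1 → TangentSpace (𝓡 n) x) :
    Prop :=
  ContMDiffOn (𝓡 n).tangent (𝓡 n).tangent ∞
    (fun p : TangentBundle (𝓡 n) M => (⟨p.1, radialExt (f p.1) p.2⟩ : TangentBundle (𝓡 n) M))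
    {p | p.2 ≠ 0}

variable {n M} in
/-- Smoothness of a section over the unit tangent bundle `SM` of the pullback of `S²TM`, seen inside
the endomorphism bundle of `TM`. -/
def IsSmoothOnSMSym
    (f : ∀ x : M, sphere (0 : TangentSpace (𝓡 n) x) 1 → symEnd (TangentSpace (𝓡 n) x)) : Prop :=
  ContMDiffOn (𝓡 n).tangent
    ((𝓡 n).prod 𝓘(ℝ, EuclideanSpace ℝ (Fin n) →L[ℝ] EuclideanSpace ℝ (Fin n))) ∞
    (fun p : TangentBundle (𝓡 n) M =>
      Bundle.TotalSpace.mk' (EuclideanSpace ℝ (Fin n) →L[ℝ] EuclideanSpace ℝ (Fin n))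
        (E := fun x : M => TangentSpace (𝓡 n) x →L[ℝ] TangentSpace (𝓡 n) x) p.1
        (LinearMap.toContinuousLinearMap
          (radialExt (f p.1) p.2 : symEnd (TangentSpace (𝓡 n) p.1)).1))
    {p | p.2 ≠ 0}

variable [T2Space M] [SigmaCompactSpace M]

/-- A smooth partition of unity subordinate to the domains of the preferred charts. -/
def chartPartition : SmoothPartitionOfUnity M (𝓡 n) M :=
  (SmoothPartitionOfUnity.exists_isSubordinate_chartAt_source (𝓡 n) M).choose

/-- The Riemannian measure `|dx|` of `M`: the local measures `√(det g_ij) dy` in the charts, glued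
by a partition of unity. -/
def riemannianMeasure [MeasurableSpace M] : Measure M :=
  Measure.sum fun i : M =>
    (chartMeasure n i).withDensity fun x => ENNReal.ofReal (chartPartition n M i x)

variable {M} in
/-- The integral `∫_M ∫_{S_xM} F(x, v) |dv| |dx|` of a function on the unit tangent bundle. -/
def integralSM [MeasurableSpace M] (F : ∀ x : M, sphere (0 : TangentSpace (𝓡 n) x) 1 → ℝ) : ℝ :=
  ∫ x, sphereIntegral (F x) ∂(riemannianMeasure n M)

variable {M} in
/-- The squared `L²` norm on the unit tangent bundle of a section of the pullback of a Euclidean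
bundle with fibres `W x`. -/
def normSqL2 [MeasurableSpace M] {W : M → Type*} [∀ x, NormedAddCommGroup (W x)]
    (f : ∀ x : M, sphere (0 : TangentSpace (𝓡 n) x) 1 → W x) : ℝ :=
  integralSM n fun x v => ‖f x v‖ ^ 2

end Manifold

end

/-! The identity already holds on each fibre $V = T_xM$, where it is a statement about harmonic
polynomials; the integration over $M$ only needs integrability.

Expanding $4G$ splits the integrand into two terms of the same shape, plus a multiple of $J$. Each
of the two is `wedgePairing B` for a bilinear contraction $B : V \times W \to U$: $B(v)w = \langle
Kv, w\rangle$ for $TM$, $B(v)A = A(Kv)$ for $S^2TM$, with $K = \mathrm{id}$ for $X\wedge Y$ and $K =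
J$ for $JX\wedge JY$. The $J$-term is the cross term in (i). In (ii) it vanishes because $[J,f]=0$,
and the same relation gives $|\iota_{Jv}f| = |\iota_v f|$.

For one contraction, let $f$ be the restriction of a solid harmonic $P$ of degree $d$ and $B(v)f$
that of a solid harmonic $Q$ of degree $d-1$. By homogeneity $B(x)P(x) = |x|^2Q(x)$ on all of $V$.
Taking Laplacians gives the divergence $\sum_i B(b_i)\partial_iP = (n+2d-2)Q$ (`divergence_eq`), and
taking first derivatives expresses $B(v)\partial_iP$ through $Q$. Inserting both gives, pointwise on
the sphere, $(n+2d-4)|Q|^2 + |P|^2 - \sum_i\langle\partial_iQ, B(b_i)P\rangle$ (`wedgePairing_eq`).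
The last sum pairs harmonics of degrees $d-2$ and $d$, so it integrates to zero
(`integral_sphere_inner_eq_zero`). The normalisation $\sum_i|B(b_i)w|^2 = |w|^2$ used here holds in
all four cases because $J$ maps orthonormal bases to orthonormal bases.

On $M$, the Riemannian measure is finite by compactness, and the fibre integrals are continuous in
$x$: a Gram–Schmidt frame identifies nearby unit spheres isometrically with a fixed one
(`continuous_sphereIntegral`). -/

noncomputable section

set_option linter.unusedSectionVars false

/-! ### Homogeneous maps, Euler's identity and solid harmonics -/

section HomogeneousHarmonic

variable {V : Type*} [NormedAddCommGroup V] [InnerProductSpace ℝ V]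
variable {W : Type*} [NormedAddCommGroup W] [NormedSpace ℝ W]
variable {U : Type*} [NormedAddCommGroup U] [NormedSpace ℝ U]

/-- `P` is positively homogeneous of degree `d`. -/
def IsHomog (d : ℤ) (P : V → W) : Prop := ∀ t : ℝ, 0 < t → ∀ v : V, P (t • v) = t ^ d • P v

theorem IsHomog.fderiv_self {d : ℤ} {P : V → W} (h : IsHomog d P) (hP : Differentiable ℝ P)
    (v : V) : fderiv ℝ P v v = (d : ℝ) • P v := by
  have h1 : HasDerivAt (fun t : ℝ => P (t • v)) (fderiv ℝ P v v) 1 := by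
    have hl : HasDerivAt (fun t : ℝ => t • v) v 1 := by
      simpa using (hasDerivAt_id (1 : ℝ)).smul_const v
    have hP' : HasFDerivAt P (fderiv ℝ P v) ((fun t : ℝ => t • v) 1) := by
      simpa using (hP v).hasFDerivAt
    exact hP'.comp_hasDerivAt (1 : ℝ) hl
  have h2 : HasDerivAt (fun t : ℝ => t ^ d • P v) ((d : ℝ) • P v) 1 := by
    simpa using (hasDerivAt_zpow d (1 : ℝ) (Or.inl one_ne_zero)).smul_const (P v)
  refine h1.unique (h2.congr_of_eventuallyEq ?_)
  filter_upwards [lt_mem_nhds (zero_lt_one' ℝ)] with t ht using h t ht v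

theorem IsHomog.fderiv {d : ℤ} {P : V → W} (h : IsHomog d P) (hP : Differentiable ℝ P) (u : V) :
    IsHomog (d - 1) (fun v => fderiv ℝ P v u) := by
  intro t ht v
  have h1 : HasFDerivAt (fun w => P (t • w)) ((_root_.fderiv ℝ P (t • v)).comp
      (t • ContinuousLinearMap.id ℝ V)) v :=
    HasFDerivAt.comp (g := P) (f := fun w => t • w) v (hP (t • v)).hasFDerivAt
      ((hasFDerivAt_id v).const_smul t)
  have h2 : HasFDerivAt (fun w => t ^ d • P w) (t ^ d • _root_.fderiv ℝ P v) v :=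
    (hP v).hasFDerivAt.const_smul (t ^ d)
  have h3 := congrArg (fun L => L u)
    (h1.unique (h2.congr_of_eventuallyEq (Filter.Eventually.of_forall fun w => h t ht w)))
  simp only [ContinuousLinearMap.comp_apply, _root_.smul_apply,
    ContinuousLinearMap.id_apply, map_smul] at h3
  rw [zpow_sub_one₀ ht.ne', mul_comm, mul_smul, ← h3, smul_smul, inv_mul_cancel₀ ht.ne', one_smul]

/-- Since $P(v) = t^{-d}P(tv)$ with $-d > 0$, letting $t \to 0^+$ gives zero by continuity at the
origin. With integer degrees this treats low $k$ uniformly. -/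
theorem IsHomog.map_zero_of_neg {d : ℤ} {P : V → W} (h : IsHomog d P) (hP : Continuous P)
    (hd : d < 0) (v : V) : P v = 0 := by
  obtain ⟨m, hm⟩ : ∃ m : ℕ, d = -((m : ℤ) + 1) := ⟨(-d - 1).toNat, by omega⟩
  have h1 : Filter.Tendsto (fun t : ℝ => t ^ (m + 1) • P (t • v)) (nhdsWithin 0 (Set.Ioi 0))
      (nhds 0) := by
    have : Continuous fun t : ℝ => t ^ (m + 1) • P (t • v) := by fun_prop
    have := this.tendsto 0
    simp only [zero_pow (Nat.succ_ne_zero m), zero_smul] at this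
    exact this.mono_left nhdsWithin_le_nhds
  refine tendsto_nhds_unique (tendsto_const_nhds.congr' ?_) h1
  filter_upwards [self_mem_nhdsWithin] with t (ht : 0 < t)
  rw [h t ht v, smul_smul, hm, zpow_neg]
  have : t ^ (m + 1) * (t ^ ((m : ℤ) + 1))⁻¹ = 1 := by
    rw [show (m : ℤ) + 1 = ((m + 1 : ℕ) : ℤ) by push_cast; ring, zpow_natCast]
    exact mul_inv_cancel₀ (pow_ne_zero _ ht.ne')
  rw [this, one_smul]

theorem IsHomog.clm_comp {d : ℤ} {P : V → W} (h : IsHomog d P) (L : W →L[ℝ] U) :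
    IsHomog d (fun v => L (P v)) := fun t ht v => by
  simp only [h t ht v, map_smul]

theorem two_le_infty : (2 : WithTop ℕ∞) ≤ ∞ := by
  exact WithTop.coe_le_coe.2 (le_top : (2 : ℕ∞) ≤ ⊤)

theorem fderiv_fderiv_comm {P : V → W} (hP : ContDiff ℝ 2 P) (x u w : V) :
    fderiv ℝ (fun y => fderiv ℝ P y u) x w = fderiv ℝ (fun y => fderiv ℝ P y w) x u := by
  have hd : DifferentiableAt ℝ (fderiv ℝ P) x :=
    ((hP.fderiv_right (m := 1) (by norm_num)).differentiable (by norm_num)) x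
  rw [fderiv_clm_apply hd (differentiableAt_const u), fderiv_clm_apply hd (differentiableAt_const w)]
  simpa using (hP.contDiffAt.isSymmSndFDerivAt (by simp)).eq w u

theorem contDiff_fderiv_const {P : V → W} (hP : ContDiff ℝ ∞ P) (u : V) :
    ContDiff ℝ ∞ (fun y => fderiv ℝ P y u) :=
  (hP.fderiv_right (m := ∞) (by simp)).clm_apply contDiff_const

variable [FiniteDimensional ℝ V]

theorem laplacian_eq_sum_fderiv {ι : Type*} [Fintype ι] (b : OrthonormalBasis ι ℝ V) {P : V → W}
    (hP : ContDiff ℝ 2 P) (x : V) :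
    Laplacian.laplacian P x = ∑ i, fderiv ℝ (fun y => fderiv ℝ P y (b i)) x (b i) := by
  rw [InnerProductSpace.laplacian_eq_iteratedFDeriv_orthonormalBasis P b]
  refine Finset.sum_congr rfl fun i _ => ?_
  have hd : DifferentiableAt ℝ (fderiv ℝ P) x :=
    ((hP.fderiv_right (m := 1) (by norm_num)).differentiable (by norm_num)) x
  rw [fderiv_clm_apply hd (differentiableAt_const _), iteratedFDeriv_two_apply]
  simp

/-- A smooth homogeneous harmonic map of degree `d`. -/
structure IsSolidHarmonic (d : ℤ) (P : V → W) : Prop where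
  contDiff : ContDiff ℝ ∞ P
  homog : IsHomog d P
  harmonic : ∀ v, Laplacian.laplacian P v = 0

theorem IsSolidHarmonic.differentiable {d : ℤ} {P : V → W} (h : IsSolidHarmonic d P) :
    Differentiable ℝ P := h.contDiff.differentiable (by simp)

/-- Constant-coefficient derivatives commute with the Laplacian, and each one lowers the degree by
one. -/
theorem IsSolidHarmonic.fderiv {d : ℤ} {P : V → W} (h : IsSolidHarmonic d P) (u : V) :
    IsSolidHarmonic (d - 1) (fun v => fderiv ℝ P v u) where
  contDiff := contDiff_fderiv_const h.contDiff u
  homog := h.homog.fderiv h.differentiable u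
  harmonic v := by
    have h2 : ∀ w, ContDiff ℝ ∞ (fun y => _root_.fderiv ℝ P y w) :=
      contDiff_fderiv_const h.contDiff
    have h3 : ∀ w w', ContDiff ℝ ∞
        (fun y => _root_.fderiv ℝ (fun z => _root_.fderiv ℝ P z w) y w') :=
      fun w w' => contDiff_fderiv_const (h2 w) w'
    set b := stdOrthonormalBasis ℝ V
    rw [laplacian_eq_sum_fderiv b ((h2 u).of_le two_le_infty)]
    have e : ∀ i, _root_.fderiv ℝ (fun y => _root_.fderiv ℝ
        (fun z => _root_.fderiv ℝ P z u) y (b i)) v (b i) =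
        _root_.fderiv ℝ (fun y => _root_.fderiv ℝ
        (fun z => _root_.fderiv ℝ P z (b i)) y (b i)) v u := fun i => by
      rw [← fderiv_fderiv_comm ((h2 (b i)).of_le two_le_infty)]
      congr 2
      funext y
      exact fderiv_fderiv_comm (h.contDiff.of_le two_le_infty) y u (b i)
    simp_rw [e]
    rw [← _root_.sum_apply, ← fderiv_fun_sum fun i _ =>
      ((h3 (b i) (b i)).differentiable (by simp)) v]
    have : (fun y => ∑ i, _root_.fderiv ℝ (fun z => _root_.fderiv ℝ P z (b i)) y (b i)) =
        fun _ => 0 := by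
      funext y
      rw [← laplacian_eq_sum_fderiv b (h.contDiff.of_le two_le_infty), h.harmonic]
    rw [this]
    simp

theorem IsSolidHarmonic.clm_comp {d : ℤ} {P : V → W} (h : IsSolidHarmonic d P) (L : W →L[ℝ] U) :
    IsSolidHarmonic d (fun v => L (P v)) where
  contDiff := L.contDiff.comp h.contDiff
  homog := h.homog.clm_comp L
  harmonic v := by
    have := (h.contDiff.contDiffAt (x := v)).of_le two_le_infty
    have h2 := this.laplacian_CLM_comp_left (l := L)
    simpa [h.harmonic v, Function.comp_def] using h2

/-- A homogeneous map is determined on `V ∖ {0}` by its restriction to the sphere. -/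
theorem IsHomog.eq_of_eqOn_sphere {d : ℤ} {P Q : V → W} (hP : IsHomog d P) (hQ : IsHomog d Q)
    (h : ∀ v : sphere (0 : V) 1, P v = Q v) {v : V} (hv : v ≠ 0) : P v = Q v := by
  have hn : 0 < ‖v‖ := norm_pos_iff.2 hv
  have hs : ‖v‖⁻¹ • v ∈ sphere (0 : V) 1 := by simp [norm_smul, hv]
  have := h ⟨_, hs⟩
  have e : v = ‖v‖ • (‖v‖⁻¹ • v) := by rw [smul_smul, mul_inv_cancel₀ hn.ne', one_smul]
  rw [e, hP _ hn, hQ _ hn, this]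

end HomogeneousHarmonic

/-! ### Orthogonality of spherical harmonics of different degrees -/

section Orthogonality

variable {V : Type*} [NormedAddCommGroup V] [InnerProductSpace ℝ V] [FiniteDimensional ℝ V]
variable {W : Type*} [NormedAddCommGroup W] [InnerProductSpace ℝ W]

/-- The nonnegative part of `1 - s`. -/
def cutoff (s : ℝ) : ℝ := max 0 (1 - s)

theorem continuous_cutoff : Continuous cutoff := by unfold cutoff; fun_prop

/-- Squaring makes the truncated weight $C^1$ across $s = 1$, where the error is at most $h^2$. This
permits integration by parts on all of $V$ without boundary terms. -/
theorem hasDerivAt_cutoff_sq (s : ℝ) :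
    HasDerivAt (fun r => cutoff r ^ 2) (-2 * cutoff s) s := by
  have hsq : HasDerivAt (fun r : ℝ => (1 - r) ^ 2) (-2 * (1 - s)) s := by
    have := ((hasDerivAt_id s).const_sub 1).pow 2
    refine (this.congr_deriv ?_)
    simp; try ring
  rcases lt_trichotomy s 1 with hs | rfl | hs
  · have : cutoff s = 1 - s := max_eq_right (by linarith)
    rw [this]
    refine hsq.congr_of_eventuallyEq ?_
    filter_upwards [gt_mem_nhds hs] with r hr
    rw [cutoff, max_eq_right (by linarith)]
  · have h0 : cutoff 1 = 0 := by simp [cutoff]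
    rw [h0, mul_zero]
    have ho : (fun h : ℝ => h ^ 2) =o[nhds 0] fun h => h := by
      simpa using (Asymptotics.isLittleO_pow_id (one_lt_two) : (fun x : ℝ => x ^ 2) =o[nhds 0] _)
    rw [hasDerivAt_iff_isLittleO_nhds_zero]
    refine Asymptotics.IsBigO.trans_isLittleO (Asymptotics.IsBigO.of_bound 1 ?_) ho
    refine Filter.Eventually.of_forall fun h => ?_
    simp only [cutoff, Real.norm_eq_abs]
    rw [one_mul, abs_of_nonneg (sq_nonneg h)]
    rcases le_total 0 h with hh | hh
    · rw [max_eq_left (by linarith)]; simp; positivity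
    · rw [max_eq_right (by linarith)]; simp
  · have : cutoff s = 0 := max_eq_left (by linarith)
    rw [this, mul_zero]
    refine (hasDerivAt_const s (0 : ℝ)).congr_of_eventuallyEq ?_
    filter_upwards [lt_mem_nhds hs] with r hr
    rw [cutoff, max_eq_left (by linarith), zero_pow two_ne_zero]

theorem cutoff_normSq_eq_zero {x : V} (hx : x ∉ closedBall (0 : V) 1) : cutoff (‖x‖ ^ 2) = 0 := by
  rw [mem_closedBall_zero_iff, not_le] at hx
  exact max_eq_left (by nlinarith)

theorem hasFDerivAt_cutoff_sq_normSq (x : V) :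
    HasFDerivAt (fun y : V => cutoff (‖y‖ ^ 2) ^ 2)
      ((-4 * cutoff (‖x‖ ^ 2)) • innerSL ℝ x) x := by
  have h := (hasDerivAt_cutoff_sq (‖x‖ ^ 2)).comp_hasFDerivAt x
    (hasStrictFDerivAt_norm_sq x).hasFDerivAt
  refine h.congr_fderiv ?_
  rw [← Nat.cast_smul_eq_nsmul ℝ, smul_smul]
  congr 1; push_cast; ring

variable [MeasurableSpace V] [BorelSpace V]

theorem integral_fderiv_eq_zero {F : V → ℝ} {F' : V → V →L[ℝ] ℝ} (hF : ∀ x, HasFDerivAt F (F' x) x)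
    (u : V) (hc : HasCompactSupport F) (hF' : Continuous fun x => F' x u) :
    ∫ x, F' x u = 0 := by
  have hz : ∀ x, x ∉ tsupport F → F' x u = 0 := by
    intro x hx
    have h0 : F =ᶠ[nhds x] fun _ => 0 := notMem_tsupport_iff_eventuallyEq.1 hx
    have := (hF x).unique ((hasFDerivAt_const (0 : ℝ) x).congr_of_eventuallyEq h0)
    simp [this]
  have hcont : Continuous F := continuous_iff_continuousAt.2 fun x => (hF x).continuousAt
  have hi' : Integrable (fun x => F' x u) :=
    hF'.integrable_of_hasCompactSupport (HasCompactSupport.intro hc hz)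
  have := integral_bilinear_hasFDerivAt_right_eq_neg_left_of_integrable (μ := (volume : Measure V))
    (f := fun _ : V => (1 : ℝ)) (f' := fun _ => 0) (g := F) (g' := F') (v := u)
    (B := ContinuousLinearMap.mul ℝ ℝ) (by simp) (by simpa using hi')
    (by simpa using hcont.integrable_of_hasCompactSupport hc)
    (fun x _ => hasFDerivAt_const _ _) (fun x _ => hF x)
  simpa using this

/-- Green's identity against the radial weight `cutoff (‖x‖ ^ 2) ^ 2`. -/
theorem integral_inner_mul_cutoff_eq_zero {a b : ℤ} (hab : a ≠ b) {P Q : V → W}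
    (hP : IsSolidHarmonic a P) (hQ : IsSolidHarmonic b Q) :
    ∫ x, ⟪P x, Q x⟫_ℝ * cutoff (‖x‖ ^ 2) = 0 := by
  set e := stdOrthonormalBasis ℝ V with he
  have hPd := hP.differentiable
  have hQd := hQ.differentiable
  have hPc := hP.contDiff.continuous
  have hQc := hQ.contDiff.continuous
  have hP1 : ∀ u, Continuous fun x => fderiv ℝ P x u := fun u => (hP.fderiv u).contDiff.continuous
  have hQ1 : ∀ u, Continuous fun x => fderiv ℝ Q x u := fun u => (hQ.fderiv u).contDiff.continuous
  have hP2 : ∀ u, Continuous fun x => fderiv ℝ (fun y => fderiv ℝ P y u) x u :=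
    fun u => ((hP.fderiv u).fderiv u).contDiff.continuous
  have hQ2 : ∀ u, Continuous fun x => fderiv ℝ (fun y => fderiv ℝ Q y u) x u :=
    fun u => ((hQ.fderiv u).fderiv u).contDiff.continuous
  have hw : Continuous fun x : V => cutoff (‖x‖ ^ 2) := continuous_cutoff.comp (by fun_prop)
  -- The $u$-component of the Green field $\langle P,\nabla Q\rangle - \langle Q,\nabla P\rangle$,
  -- times the compactly supported weight, has a $u$-derivative of integral zero.
  have key : ∀ u : V, ∫ x, ((⟪P x, fderiv ℝ (fun y => fderiv ℝ Q y u) x u⟫_ℝ -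
      ⟪Q x, fderiv ℝ (fun y => fderiv ℝ P y u) x u⟫_ℝ) * cutoff (‖x‖ ^ 2) ^ 2 +
      (⟪P x, fderiv ℝ Q x u⟫_ℝ - ⟪Q x, fderiv ℝ P x u⟫_ℝ) *
        (-4 * cutoff (‖x‖ ^ 2) * ⟪x, u⟫_ℝ)) = 0 := by
    intro u
    have hF := fun x => ((((hPd x).hasFDerivAt.inner ℝ
      ((hQ.fderiv u).differentiable x).hasFDerivAt).sub ((hQd x).hasFDerivAt.inner ℝ
      ((hP.fderiv u).differentiable x).hasFDerivAt)).mul (hasFDerivAt_cutoff_sq_normSq x))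
    have h0 := integral_fderiv_eq_zero hF u ?_ ?_
    · rw [← h0]
      congr 1
      funext x
      simp [fderivInnerCLM_apply, real_inner_comm]
      ring
    · refine HasCompactSupport.intro (isCompact_closedBall (0 : V) 1) fun x hx => ?_
      simp [cutoff_normSq_eq_zero hx]
    · simp only [Pi.sub_apply, _root_.add_apply, _root_.smul_apply,
        _root_.sub_apply, ContinuousLinearMap.comp_apply,
        ContinuousLinearMap.prod_apply, fderivInnerCLM_apply, innerSL_apply_apply, smul_eq_mul]
      have := hP1 u; have := hQ1 u; have := hP2 u; have := hQ2 u
      fun_prop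
  have hint : ∀ i, Integrable (fun x => ((⟪P x, fderiv ℝ (fun y => fderiv ℝ Q y (e i)) x (e i)⟫_ℝ -
      ⟪Q x, fderiv ℝ (fun y => fderiv ℝ P y (e i)) x (e i)⟫_ℝ) * cutoff (‖x‖ ^ 2) ^ 2 +
      (⟪P x, fderiv ℝ Q x (e i)⟫_ℝ - ⟪Q x, fderiv ℝ P x (e i)⟫_ℝ) *
        (-4 * cutoff (‖x‖ ^ 2) * ⟪x, e i⟫_ℝ))) := by
    intro i
    have := hP1 (e i); have := hQ1 (e i); have := hP2 (e i); have := hQ2 (e i)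
    refine Continuous.integrable_of_hasCompactSupport (by fun_prop)
      (HasCompactSupport.intro (isCompact_closedBall (0 : V) 1) fun x hx => ?_)
    simp [cutoff_normSq_eq_zero hx]
  have hsum := integral_finsetSum (μ := (volume : Measure V)) Finset.univ fun i _ => hint i
  rw [Finset.sum_eq_zero fun i _ => key (e i)] at hsum
  -- Summed over the basis, the second-order terms become Laplacians and vanish. The gradient of the
  -- weight is radial, so Euler's identity turns the first-order terms into $(b-a)\langle
  -- P,Q\rangle$.
  have hpt : ∀ x, (∑ i, ((⟪P x, fderiv ℝ (fun y => fderiv ℝ Q y (e i)) x (e i)⟫_ℝ -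
      ⟪Q x, fderiv ℝ (fun y => fderiv ℝ P y (e i)) x (e i)⟫_ℝ) * cutoff (‖x‖ ^ 2) ^ 2 +
      (⟪P x, fderiv ℝ Q x (e i)⟫_ℝ - ⟪Q x, fderiv ℝ P x (e i)⟫_ℝ) *
        (-4 * cutoff (‖x‖ ^ 2) * ⟪x, e i⟫_ℝ))) =
      (-4 * ((b : ℝ) - a)) * (⟪P x, Q x⟫_ℝ * cutoff (‖x‖ ^ 2)) := by
    intro x
    have hx : ∀ {R : V → W}, ∑ i, ⟪x, e i⟫_ℝ • fderiv ℝ R x (e i) = fderiv ℝ R x x := by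
      intro R
      conv_rhs => rw [← e.sum_repr' x, map_sum]
      refine Finset.sum_congr rfl fun i _ => ?_
      rw [map_smul, real_inner_comm]
      rw [e.sum_repr']
    have h1 : ∑ i, ⟪x, e i⟫_ℝ * ⟪P x, fderiv ℝ Q x (e i)⟫_ℝ = b * ⟪P x, Q x⟫_ℝ := by
      simp_rw [← real_inner_smul_right, ← inner_sum, hx, hQ.homog.fderiv_self hQd]
    have h2 : ∑ i, ⟪x, e i⟫_ℝ * ⟪Q x, fderiv ℝ P x (e i)⟫_ℝ = a * ⟪P x, Q x⟫_ℝ := by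
      simp_rw [← real_inner_smul_right, ← inner_sum, hx, hP.homog.fderiv_self hPd,
        real_inner_smul_right]
      rw [real_inner_comm]
    have h3 : ∑ i, ⟪P x, fderiv ℝ (fun y => fderiv ℝ Q y (e i)) x (e i)⟫_ℝ = 0 := by
      rw [← inner_sum, ← laplacian_eq_sum_fderiv e (hQ.contDiff.of_le two_le_infty), hQ.harmonic,
        inner_zero_right]
    have h4 : ∑ i, ⟪Q x, fderiv ℝ (fun y => fderiv ℝ P y (e i)) x (e i)⟫_ℝ = 0 := by
      rw [← inner_sum, ← laplacian_eq_sum_fderiv e (hP.contDiff.of_le two_le_infty), hP.harmonic,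
        inner_zero_right]
    calc _ = (∑ i, ⟪P x, fderiv ℝ (fun y => fderiv ℝ Q y (e i)) x (e i)⟫_ℝ -
          ∑ i, ⟪Q x, fderiv ℝ (fun y => fderiv ℝ P y (e i)) x (e i)⟫_ℝ) * cutoff (‖x‖ ^ 2) ^ 2 +
          (∑ i, ⟪x, e i⟫_ℝ * ⟪P x, fderiv ℝ Q x (e i)⟫_ℝ -
          ∑ i, ⟪x, e i⟫_ℝ * ⟪Q x, fderiv ℝ P x (e i)⟫_ℝ) * (-4 * cutoff (‖x‖ ^ 2)) := by
            rw [← Finset.sum_sub_distrib, ← Finset.sum_sub_distrib, Finset.sum_mul, Finset.sum_mul,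
              ← Finset.sum_add_distrib]
            exact Finset.sum_congr rfl fun i _ => by ring
      _ = _ := by rw [h1, h2, h3, h4]; ring
  simp_rw [hpt] at hsum
  rw [integral_const_mul] at hsum
  refine (mul_eq_zero.1 hsum).resolve_left ?_
  have : (a : ℝ) ≠ b := by exact_mod_cast hab
  exact mul_ne_zero (by norm_num) (sub_ne_zero.2 this.symm)

/-- Polar coordinates: the radial factor depends on $H$ only through its degree, so it can be tested
on any other function of that degree. -/
theorem integral_homog_mul_radial (m : ℕ) {H : V → ℝ} (hH : IsHomog m H) (g : ℝ → ℝ)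
    [Nontrivial V] :
    ∫ x, H x * g ‖x‖ = (∫ v : sphere (0 : V) 1, H v ∂(volume : Measure V).toSphere) *
      ∫ r : Set.Ioi (0 : ℝ), r.1 ^ m * g r ∂(Measure.volumeIoiPow (Module.finrank ℝ V - 1)) := by
  calc ∫ x, H x * g ‖x‖ = ∫ x : ({(0)}ᶜ : Set V), H x * g ‖x.1‖ ∂((volume : Measure V).comap (↑)) := by
        rw [integral_subtype_comap (measurableSet_singleton _).compl fun x => H x * g ‖x‖,
          restrict_compl_singleton]
    _ = ∫ p : sphere (0 : V) 1 × Set.Ioi (0 : ℝ), H p.1 * (p.2.1 ^ m * g p.2.1)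
          ∂((volume : Measure V).toSphere.prod
            (Measure.volumeIoiPow (Module.finrank ℝ V - 1))) := by
        rw [← (volume : Measure V).measurePreserving_homeomorphUnitSphereProd.integral_comp
          (Homeomorph.measurableEmbedding _)]
        refine integral_congr_ae (Filter.Eventually.of_forall fun x => ?_)
        have hn : 0 < ‖x.1‖ := norm_pos_iff.2 x.2
        have e : x.1 = ‖x.1‖ • (‖x.1‖⁻¹ • x.1) := by
          rw [smul_smul, mul_inv_cancel₀ hn.ne', one_smul]
        have := hH _ hn (‖x.1‖⁻¹ • x.1)
        rw [← e] at this
        simp [this]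
        ring
    _ = _ := integral_prod_mul (fun v : sphere (0 : V) 1 => H v)
        (fun r : Set.Ioi (0 : ℝ) => r.1 ^ m * g r)

/-- Spherical harmonics of different degrees are orthogonal. -/
theorem integral_sphere_inner_eq_zero {a b : ℤ} (hab : a ≠ b) {P Q : V → W}
    (hP : IsSolidHarmonic a P) (hQ : IsSolidHarmonic b Q) :
    ∫ v : sphere (0 : V) 1, ⟪P v, Q v⟫_ℝ ∂(volume : Measure V).toSphere = 0 := by
  -- Negative degrees do occur: $\partial_iQ$ has degree $k-2$.
  rcases lt_or_ge a 0 with ha | ha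
  · simp [hP.homog.map_zero_of_neg hP.contDiff.continuous ha]
  rcases lt_or_ge b 0 with hb | hb
  · simp [hQ.homog.map_zero_of_neg hQ.contDiff.continuous hb]
  lift a to ℕ using ha
  lift b to ℕ using hb
  rcases subsingleton_or_nontrivial V with hV | hV
  · rw [(volume : Measure V).toSphere_eq_zero_iff.2 hV, integral_zero_measure]
  have hH : IsHomog ((a + b : ℕ) : ℤ) fun v => ⟪P v, Q v⟫_ℝ := fun t ht v => by
    simp only [hP.homog t ht v, hQ.homog t ht v, real_inner_smul_left, real_inner_smul_right,
      zpow_natCast, smul_eq_mul, pow_add]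
    ring
  -- The power $\|v\|^{a+b}$ has the same radial factor and a positive integral against the weight,
  -- so this factor is nonzero and the spherical one must vanish.
  have hN : IsHomog ((a + b : ℕ) : ℤ) fun v : V => ‖v‖ ^ (a + b) := fun t ht v => by
    simp only [norm_smul, Real.norm_of_nonneg ht.le, mul_pow, zpow_natCast, smul_eq_mul]
  have h1 := integral_homog_mul_radial _ hH (fun r => cutoff (r ^ 2))
  have h2 := integral_homog_mul_radial _ hN (fun r => cutoff (r ^ 2))
  rw [integral_inner_mul_cutoff_eq_zero hab hP hQ] at h1
  refine (mul_eq_zero.1 h1.symm).resolve_right fun h0 => ?_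
  rw [h0, mul_zero] at h2
  obtain ⟨v, hv⟩ := exists_ne (0 : V)
  have hpos := Continuous.integral_pos_of_hasCompactSupport_nonneg_nonzero
    (μ := (volume : Measure V)) (f := fun x : V => ‖x‖ ^ (a + b) * cutoff (‖x‖ ^ 2))
    (x := (2 * ‖v‖)⁻¹ • v) ?_ ?_ ?_ ?_
  · exact hpos.ne' h2
  · exact (by fun_prop : Continuous fun x : V => ‖x‖ ^ (a + b)).mul
      (continuous_cutoff.comp (by fun_prop))
  · exact HasCompactSupport.intro (isCompact_closedBall (0 : V) 1) fun x hx => by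
      simp [cutoff_normSq_eq_zero hx]
  · exact fun x => mul_nonneg (by positivity) (le_max_left _ _)
  · have hv' : 0 < ‖v‖ := norm_pos_iff.2 hv
    have : ‖(2 * ‖v‖)⁻¹ • v‖ = 1 / 2 := by
      rw [norm_smul, norm_inv, Real.norm_of_nonneg (by positivity)]
      field_simp
    simp only [this, cutoff]
    norm_num

end Orthogonality

/-! ### The round gradient in terms of a homogeneous extension -/

section SphereGradient

variable {V : Type*} [NormedAddCommGroup V] [InnerProductSpace ℝ V] [FiniteDimensional ℝ V]

theorem hasFDerivAt_normalize {v : V} (hv : ‖v‖ = 1) :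
    HasFDerivAt (fun w : V => ‖w‖⁻¹ • w) (ContinuousLinearMap.id ℝ V -
      (innerSL ℝ v).smulRight v) v := by
  have hn : HasFDerivAt (fun w : V => (‖w‖ ^ 2)) (2 • innerSL ℝ v) v :=
    (hasStrictFDerivAt_norm_sq v).hasFDerivAt
  have hs := (hasDerivAt_inv (x := √(‖v‖ ^ 2)) (by simp [hv])).comp_hasFDerivAt v
    (hn.sqrt (by simp [hv]))
  have e : (fun w : V => ‖w‖⁻¹) = fun w => (√(‖w‖ ^ 2))⁻¹ := by
    funext w; rw [Real.sqrt_sq (norm_nonneg w)]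
  have h1 : HasFDerivAt (fun w : V => ‖w‖⁻¹) (-innerSL ℝ v) v := by
    rw [e]
    refine HasFDerivAt.congr_fderiv (f := fun w : V => (√(‖w‖ ^ 2))⁻¹) hs ?_
    ext u
    simp [hv]
  refine (h1.smul (hasFDerivAt_id v)).congr_fderiv ?_
  ext u
  simp [hv, sub_eq_add_neg]

theorem radialExt_of_ne {W : Type*} [Zero W] (f : sphere (0 : V) 1 → W) {w : V} (hw : w ≠ 0) :
    radialExt f w = f ⟨‖w‖⁻¹ • w, by simp [norm_smul, hw]⟩ := dif_neg hw

theorem radialExt_coe {W : Type*} [Zero W] (f : sphere (0 : V) 1 → W) (v : sphere (0 : V) 1) :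
    radialExt f v = f v := by
  rw [radialExt_of_ne f (ne_zero_of_mem_unit_sphere v)]
  congr 1
  ext
  simp

/-- The extension is $P$ composed with $w \mapsto w/\|w\|$, whose derivative at a unit vector is the
tangential projection. Euler's identity evaluates the removed radial part as $d\,P(v)$. -/
theorem hasFDerivAt_radialExt {W : Type*} [NormedAddCommGroup W] [NormedSpace ℝ W] {d : ℤ}
    {P : V → W} (hP : Differentiable ℝ P) (hd : IsHomog d P) {f : sphere (0 : V) 1 → W}
    (hf : ∀ v : sphere (0 : V) 1, P v = f v) (v : sphere (0 : V) 1) :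
    HasFDerivAt (radialExt f)
      (fderiv ℝ P v - (innerSL ℝ (v : V)).smulRight ((d : ℝ) • P v)) v := by
  have hv : ‖(v : V)‖ = 1 := norm_eq_of_mem_sphere v
  have hP' : HasFDerivAt P (fderiv ℝ P v) ((fun w : V => ‖w‖⁻¹ • w) v) := by
    simpa [hv] using (hP (v : V)).hasFDerivAt
  have h := HasFDerivAt.comp (g := P) (f := fun w : V => ‖w‖⁻¹ • w) (v : V) hP'
    (hasFDerivAt_normalize hv)
  have h' : HasFDerivAt (radialExt f) _ (v : V) := h.congr_of_eventuallyEq <| by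
    filter_upwards [isOpen_ne.mem_nhds (ne_zero_of_mem_unit_sphere v)] with w hw
    rw [radialExt_of_ne f hw, ← hf]
    rfl
  refine h'.congr_fderiv ?_
  ext u
  simp [hd.fderiv_self hP]

theorem inner_sphereGrad {d : ℤ} {p : V → ℝ} (hp : Differentiable ℝ p) (hd : IsHomog d p)
    {φ : sphere (0 : V) 1 → ℝ} (hφ : ∀ v : sphere (0 : V) 1, p v = φ v) (v : sphere (0 : V) 1)
    (u : V) : ⟪sphereGrad φ v, u⟫_ℝ = fderiv ℝ p v u - d * ⟪(v : V), u⟫_ℝ * p v := by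
  have : CompleteSpace V := FiniteDimensional.complete ℝ V
  have h := hasFDerivAt_radialExt hp hd hφ v
  rw [sphereGrad, gradient, InnerProductSpace.toDual_symm_apply, h.fderiv]
  simp
  ring

end SphereGradient

/-! ### The wedge identity for a bilinear contraction on one fibre -/

section FibreIdentity

variable {V : Type*} [NormedAddCommGroup V] [InnerProductSpace ℝ V] [FiniteDimensional ℝ V]
variable {W : Type*} [NormedAddCommGroup W] [InnerProductSpace ℝ W] [FiniteDimensional ℝ W]
variable {U : Type*} [NormedAddCommGroup U] [InnerProductSpace ℝ U]

theorem isSphericalHarmonic_iff {d : ℤ} {f : sphere (0 : V) 1 → W} :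
    IsSphericalHarmonic d f ↔
      ∃ P : V → W, IsSolidHarmonic d P ∧ ∀ v : sphere (0 : V) 1, P v = f v :=
  ⟨fun ⟨P, h1, h2, h3, h4⟩ => ⟨P, ⟨h1, h2, h3⟩, h4⟩,
    fun ⟨P, ⟨h1, h2, h3⟩, h4⟩ => ⟨P, h1, h2, h3, h4⟩⟩

variable (B : V →L[ℝ] W →L[ℝ] U)

theorem hasFDerivAt_contraction {P : V → W} (hP : Differentiable ℝ P) (x : V) :
    HasFDerivAt (fun v => B v (P v)) ((B x).comp (fderiv ℝ P x) + B.flip (P x)) x := by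
  refine (B.hasFDerivAt_of_bilinear (hasFDerivAt_id x) (hP x).hasFDerivAt).congr_fderiv ?_
  ext u
  simp

/-- Leibniz rule: as $B$ is linear in the position, only the mixed terms and the Laplacian of $P$
survive. -/
theorem laplacian_contraction {P : V → W} (hP : ContDiff ℝ ∞ P) {ι : Type*} [Fintype ι]
    (b : OrthonormalBasis ι ℝ V) (x : V) :
    Laplacian.laplacian (fun v => B v (P v)) x =
      (2 : ℝ) • ∑ i, B (b i) (fderiv ℝ P x (b i)) + B x (Laplacian.laplacian P x) := by
  have hPd : Differentiable ℝ P := hP.differentiable (by simp)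
  have hc : ContDiff ℝ ∞ fun v => B v (P v) := B.contDiff.clm_apply hP
  rw [laplacian_eq_sum_fderiv b (hc.of_le two_le_infty),
    laplacian_eq_sum_fderiv b (hP.of_le two_le_infty), map_sum, Finset.smul_sum,
    ← Finset.sum_add_distrib]
  refine Finset.sum_congr rfl fun i _ => ?_
  have e : (fun y => fderiv ℝ (fun v => B v (P v)) y (b i)) =
      fun y => B y (fderiv ℝ P y (b i)) + B (b i) (P y) := by
    funext y
    rw [(hasFDerivAt_contraction B hPd y).fderiv]
    simp
  have h1 := hasFDerivAt_contraction B
    ((contDiff_fderiv_const hP (b i)).differentiable (by simp)) x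
  have h2 := (B (b i)).hasFDerivAt.comp x (hPd x).hasFDerivAt
  rw [e, HasFDerivAt.fderiv (f := fun y => B y (fderiv ℝ P y (b i)) + B (b i) (P y)) (h1.add h2)]
  simp only [_root_.add_apply, ContinuousLinearMap.comp_apply, ContinuousLinearMap.flip_apply,
    two_smul]
  abel

theorem hasFDerivAt_normSq_smul {Q : V → U} (hQ : Differentiable ℝ Q) (x : V) :
    HasFDerivAt (fun v => ‖v‖ ^ 2 • Q v)
      (‖x‖ ^ 2 • fderiv ℝ Q x + ((2 : ℝ) • innerSL ℝ x).smulRight (Q x)) x := by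
  refine ((hasStrictFDerivAt_norm_sq x).hasFDerivAt.smul (hQ x).hasFDerivAt).congr_fderiv ?_
  ext u
  simp

theorem laplacian_normSq_smul {d : ℤ} {Q : V → U} (hQ : IsSolidHarmonic d Q) (x : V) :
    Laplacian.laplacian (fun v => ‖v‖ ^ 2 • Q v) x =
      (2 * (Module.finrank ℝ V : ℝ) + 4 * d) • Q x := by
  have hQd := hQ.differentiable
  set b := stdOrthonormalBasis ℝ V
  have hc : ContDiff ℝ ∞ fun v : V => ‖v‖ ^ 2 • Q v := (contDiff_norm_sq ℝ).smul hQ.contDiff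
  rw [laplacian_eq_sum_fderiv b (hc.of_le two_le_infty)]
  have e : ∀ u, fderiv ℝ (fun y => fderiv ℝ (fun v : V => ‖v‖ ^ 2 • Q v) y u) x u =
      ‖x‖ ^ 2 • fderiv ℝ (fun y => fderiv ℝ Q y u) x u + (2 * ‖u‖ ^ 2) • Q x +
      (4 : ℝ) • (⟪u, x⟫_ℝ • fderiv ℝ Q x u) := by
    intro u
    have e : (fun y => fderiv ℝ (fun v : V => ‖v‖ ^ 2 • Q v) y u) =
        fun y => ‖y‖ ^ 2 • fderiv ℝ Q y u + ((2 : ℝ) • innerSL ℝ u) y • Q y := by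
      funext y
      rw [(hasFDerivAt_normSq_smul hQd y).fderiv]
      simp [real_inner_comm]
    have h1 := hasFDerivAt_normSq_smul (hQ.fderiv u).differentiable x
    have h2 := (((2 : ℝ) • innerSL ℝ u).hasFDerivAt (x := x)).smul (hQd x).hasFDerivAt
    rw [e, HasFDerivAt.fderiv (f := fun y => ‖y‖ ^ 2 • fderiv ℝ Q y u +
      ((2 : ℝ) • innerSL ℝ u) y • Q y) (h1.add h2)]
    simp only [_root_.add_apply, _root_.smul_apply, ContinuousLinearMap.smulRight_apply,
      innerSL_apply_apply, real_inner_self_eq_norm_sq, smul_eq_mul, real_inner_comm x u]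
    module
  simp_rw [e, Finset.sum_add_distrib, ← Finset.smul_sum]
  rw [← laplacian_eq_sum_fderiv b (hQ.contDiff.of_le two_le_infty), hQ.harmonic]
  have h3 : ∑ i, ⟪b i, x⟫_ℝ • fderiv ℝ Q x (b i) = (d : ℝ) • Q x := by
    rw [← hQ.homog.fderiv_self hQd]
    conv_rhs => rw [← b.sum_repr' x, map_sum]
    simp_rw [map_smul, b.sum_repr']
  rw [h3]
  simp only [OrthonormalBasis.norm_eq_one, Finset.sum_const, Finset.card_univ, Fintype.card_fin]
  module

variable {d : ℤ} {P : V → W} {Q : V → U}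

theorem contraction_eq_normSq_smul (hP : IsHomog d P) (hQ : IsHomog (d - 1) Q)
    (h : ∀ v : sphere (0 : V) 1, B v (P v) = Q v) (x : V) : B x (P x) = ‖x‖ ^ 2 • Q x := by
  rcases eq_or_ne x 0 with rfl | hx
  · simp
  refine IsHomog.eq_of_eqOn_sphere (d := d + 1) (P := fun x => B x (P x))
    (Q := fun x => ‖x‖ ^ 2 • Q x) ?_ ?_ ?_ hx
  · intro t ht v
    simp only [hP t ht v, map_smul, _root_.smul_apply, smul_smul, zpow_add_one₀ ht.ne']
  · intro t ht v
    simp only [hQ t ht v, norm_smul, smul_smul, zpow_add_one₀ ht.ne', zpow_sub_one₀ ht.ne']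
    congr 1
    rw [Real.norm_of_nonneg ht.le]
    field_simp
  · intro v
    simp [h v]

/-- The divergence of a harmonic `P` whose contraction with the position vector restricts to the
harmonic `Q` on the sphere. -/
theorem divergence_eq (hP : IsSolidHarmonic d P) (hQ : IsSolidHarmonic (d - 1) Q)
    (h : ∀ v : sphere (0 : V) 1, B v (P v) = Q v) {ι : Type*} [Fintype ι]
    (b : OrthonormalBasis ι ℝ V) (x : V) :
    ∑ i, B (b i) (fderiv ℝ P x (b i)) =
      ((Module.finrank ℝ V : ℝ) + 2 * d - 2) • Q x := by
  have h1 := laplacian_contraction B hP.contDiff b x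
  have h2 : (fun v => B v (P v)) = fun v => ‖v‖ ^ 2 • Q v :=
    funext (contraction_eq_normSq_smul B hP.homog hQ.homog h)
  rw [h2, laplacian_normSq_smul hQ, hP.harmonic, map_zero, add_zero] at h1
  have h3 : ∑ i, B (b i) (fderiv ℝ P x (b i)) =
      (1 / 2 : ℝ) • (2 : ℝ) • ∑ i, B (b i) (fderiv ℝ P x (b i)) := by
    rw [smul_smul]; norm_num
  rw [h3, ← h1, smul_smul]
  congr 1
  push_cast
  ring

/-- `∑_α ⟨B(∇f_α) e_α, B(v) f⟩ - ⟨B(v) e_α, B(∇f_α) f⟩`. -/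
def wedgePairing (f : sphere (0 : V) 1 → W) (v : sphere (0 : V) 1) : ℝ :=
  ∑ α, (⟪B (sphereGrad (fun w => ⟪f w, stdOrthonormalBasis ℝ W α⟫_ℝ) v)
      (stdOrthonormalBasis ℝ W α), B v (f v)⟫_ℝ -
    ⟪B v (stdOrthonormalBasis ℝ W α),
      B (sphereGrad (fun w => ⟪f w, stdOrthonormalBasis ℝ W α⟫_ℝ) v) (f v)⟫_ℝ)

/-- Reassembles the componentwise gradients into the tangential part of the derivative of $P$, which
removes the basis of $W$ from later computations. -/
theorem sum_inner_sphereGrad_smul (hP : Differentiable ℝ P) (hd : IsHomog d P)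
    {f : sphere (0 : V) 1 → W} (hf : ∀ v : sphere (0 : V) 1, P v = f v) (v : sphere (0 : V) 1)
    (u : V) :
    ∑ α, ⟪sphereGrad (fun w => ⟪f w, stdOrthonormalBasis ℝ W α⟫_ℝ) v, u⟫_ℝ •
      stdOrthonormalBasis ℝ W α = fderiv ℝ P v u - ((d : ℝ) * ⟪(v : V), u⟫_ℝ) • P v := by
  set e := stdOrthonormalBasis ℝ W
  rw [← e.sum_repr' (fderiv ℝ P v u - ((d : ℝ) * ⟪(v : V), u⟫_ℝ) • P v)]
  refine Finset.sum_congr rfl fun α _ => ?_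
  congr 1
  have hp : Differentiable ℝ fun w => innerSL ℝ (e α) (P w) :=
    (innerSL ℝ (e α)).differentiable.comp hP
  rw [inner_sphereGrad hp (hd.clm_comp (innerSL ℝ (e α)))
    (fun w => by rw [hf w, innerSL_apply_apply, real_inner_comm]),
    HasFDerivAt.fderiv (f := fun w => innerSL ℝ (e α) (P w))
      ((innerSL ℝ (e α)).hasFDerivAt.comp (v : V) (hP v).hasFDerivAt)]
  simp [inner_sub_right, real_inner_smul_right]

/-- The divergence contributes $n+2d-2$; the derivative of $\|x\|^2$ in the second summand of the
pairing lowers this by $2$. -/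
theorem wedgePairing_eq (hB : ∀ w, ∑ i, ‖B (stdOrthonormalBasis ℝ V i) w‖ ^ 2 = ‖w‖ ^ 2)
    (hP : IsSolidHarmonic d P) (hQ : IsSolidHarmonic (d - 1) Q)
    (h : ∀ v : sphere (0 : V) 1, B v (P v) = Q v)
    {f : sphere (0 : V) 1 → W} (hf : ∀ v : sphere (0 : V) 1, P v = f v) (v : sphere (0 : V) 1) :
    wedgePairing B f v = ((Module.finrank ℝ V : ℝ) + 2 * d - 4) * ‖Q v‖ ^ 2 + ‖P v‖ ^ 2 -
      ∑ i, ⟪fderiv ℝ Q v (stdOrthonormalBasis ℝ V i), B (stdOrthonormalBasis ℝ V i) (P v)⟫_ℝ := by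
  set b := stdOrthonormalBasis ℝ V
  set e := stdOrthonormalBasis ℝ W with he
  have hv : ‖(v : V)‖ = 1 := norm_eq_of_mem_sphere v
  set Y := fun α => sphereGrad (fun w => ⟪f w, e α⟫_ℝ) v with hY
  have hsum : wedgePairing B f v = ∑ i, (⟪B (b i) (∑ α, ⟪Y α, b i⟫_ℝ • e α), Q v⟫_ℝ -
      ⟪B v (∑ α, ⟪Y α, b i⟫_ℝ • e α), B (b i) (P v)⟫_ℝ) := by
    have hα : ∀ α, (⟪B (Y α) (e α), Q v⟫_ℝ - ⟪B v (e α), B (Y α) (P v)⟫_ℝ) =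
        ∑ i, (⟪Y α, b i⟫_ℝ * ⟪B (b i) (e α), Q v⟫_ℝ -
          ⟪Y α, b i⟫_ℝ * ⟪B v (e α), B (b i) (P v)⟫_ℝ) := by
      intro α
      conv_lhs => rw [← b.sum_repr' (Y α)]
      simp only [map_sum, map_smul, _root_.sum_apply, _root_.smul_apply, sum_inner, inner_sum,
        real_inner_smul_left, real_inner_smul_right, ← Finset.sum_sub_distrib,
        real_inner_comm (Y α)]
    have : wedgePairing B f v = ∑ α, (⟪B (Y α) (e α), Q v⟫_ℝ - ⟪B v (e α), B (Y α) (P v)⟫_ℝ) := by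
      rw [wedgePairing]
      simp only [← hf v, h v]
      rfl
    rw [this, Finset.sum_congr rfl fun α _ => hα α, Finset.sum_comm]
    refine Finset.sum_congr rfl fun i _ => ?_
    simp only [map_sum, map_smul, sum_inner, real_inner_smul_left, ← Finset.sum_sub_distrib]
  have hZ : ∀ i, ∑ α, ⟪Y α, b i⟫_ℝ • e α =
      fderiv ℝ P v (b i) - ((d : ℝ) * ⟪(v : V), b i⟫_ℝ) • P v := fun i =>
    sum_inner_sphereGrad_smul hP.differentiable hP.homog hf v (b i)
  -- Differentiate $B(x)P(x) = \|x\|^2Q(x)$ in direction $b_i$ at a unit vector.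
  have hq : ∀ i, B v (fderiv ℝ P v (b i)) =
      fderiv ℝ Q v (b i) + (2 * ⟪(v : V), b i⟫_ℝ) • Q v - B (b i) (P v) := by
    intro i
    have h2 : (fun v => B v (P v)) = fun v => ‖v‖ ^ 2 • Q v :=
      funext (contraction_eq_normSq_smul B hP.homog hQ.homog h)
    have h3 := hasFDerivAt_contraction B hP.differentiable (v : V)
    rw [h2] at h3
    have h4 := congrArg (fun L => L (b i))
      (h3.unique (hasFDerivAt_normSq_smul hQ.differentiable (v : V)))
    simp only [_root_.add_apply, ContinuousLinearMap.comp_apply, ContinuousLinearMap.flip_apply,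
      _root_.smul_apply, ContinuousLinearMap.smulRight_apply, hv, innerSL_apply_apply, one_pow,
      one_smul, smul_eq_mul] at h4
    rw [← h4]
    abel
  have hBv : ∑ i, ⟪(v : V), b i⟫_ℝ • B (b i) (P v) = Q v := by
    rw [← h v, ← B.flip_apply]
    generalize P (v : V) = p
    conv_rhs => rw [← b.sum_repr' (v : V)]
    simp only [map_sum, map_smul, ContinuousLinearMap.flip_apply, real_inner_comm (v : V)]
  have hdiv := divergence_eq B hP hQ h b v
  -- The radial corrections $d\langle v,b_i\rangle P$ enter both summands equally and cancel in the
  -- difference.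
  have hterm : ∀ i, (⟪B (b i) (∑ α, ⟪Y α, b i⟫_ℝ • e α), Q v⟫_ℝ -
      ⟪B v (∑ α, ⟪Y α, b i⟫_ℝ • e α), B (b i) (P v)⟫_ℝ) =
      ⟪B (b i) (fderiv ℝ P v (b i)), Q v⟫_ℝ -
        2 * ⟪⟪(v : V), b i⟫_ℝ • B (b i) (P v), Q v⟫_ℝ
      + ‖B (b i) (P v)‖ ^ 2 - ⟪fderiv ℝ Q v (b i), B (b i) (P v)⟫_ℝ := by
    intro i
    rw [hZ i, map_sub, map_sub, map_smul, map_smul, hq i, h v]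
    simp only [inner_sub_left, inner_add_left, real_inner_smul_left,
      ← real_inner_self_eq_norm_sq, real_inner_comm (Q v) (B (b i) (P v))]
    ring
  rw [hsum, Finset.sum_congr rfl fun i _ => hterm i]
  rw [Finset.sum_sub_distrib, Finset.sum_add_distrib, Finset.sum_sub_distrib, ← Finset.mul_sum,
    ← sum_inner, ← sum_inner, hBv, hdiv, hB, real_inner_smul_left, real_inner_self_eq_norm_sq]
  ring

theorem sphereIntegral_eq [MeasurableSpace V] [hV : BorelSpace V] (F : sphere (0 : V) 1 → ℝ) :
    sphereIntegral F = ∫ v, F v ∂(volume : Measure V).toSphere := by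
  have := hV.measurable_eq
  subst this
  rfl

theorem sphereIntegral_wedgePairing
    (hB : ∀ w, ∑ i, ‖B (stdOrthonormalBasis ℝ V i) w‖ ^ 2 = ‖w‖ ^ 2)
    {f : sphere (0 : V) 1 → W} (hf : IsSphericalHarmonic d f)
    (hι : IsSphericalHarmonic (d - 1) fun v => B v (f v)) :
    sphereIntegral (wedgePairing B f) = ((Module.finrank ℝ V : ℝ) + 2 * d - 4) *
      sphereIntegral (fun v => ‖B v (f v)‖ ^ 2) + sphereIntegral (fun v => ‖f v‖ ^ 2) := by
  obtain ⟨P, hP, hPf⟩ := isSphericalHarmonic_iff.1 hf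
  obtain ⟨Q, hQ, hQf⟩ : ∃ Q : V → U, IsSolidHarmonic (d - 1) Q ∧ ∀ v : sphere (0 : V) 1,
      Q v = B v (f v) := by
    obtain ⟨Q, h1, h2, h3, h4⟩ := hι
    exact ⟨Q, ⟨h1, h2, h3⟩, h4⟩
  have h : ∀ v : sphere (0 : V) 1, B v (P v) = Q v := fun v => by rw [hPf, hQf]
  let _ : MeasurableSpace V := borel V
  have : BorelSpace V := ⟨rfl⟩
  simp only [sphereIntegral_eq]
  set μ := (volume : Measure V).toSphere
  have hint : ∀ {g : V → ℝ}, Continuous g → Integrable (fun v : sphere (0 : V) 1 => g v) μ :=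
    fun hg => (hg.comp continuous_subtype_val).integrable_of_hasCompactSupport
      (HasCompactSupport.of_compactSpace _)
  have hPc := hP.contDiff.continuous
  have hQc := hQ.contDiff.continuous
  have hi : ∀ i, Integrable (fun v : sphere (0 : V) 1 =>
      ⟪fderiv ℝ Q v (stdOrthonormalBasis ℝ V i), B (stdOrthonormalBasis ℝ V i) (P v)⟫_ℝ) μ := by
    intro i
    have := (hQ.fderiv (stdOrthonormalBasis ℝ V i)).contDiff.continuous
    exact hint (g := fun v => ⟪fderiv ℝ Q v (stdOrthonormalBasis ℝ V i),
      B (stdOrthonormalBasis ℝ V i) (P v)⟫_ℝ) (by fun_prop)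
  have hQ2 : Integrable (fun v : sphere (0 : V) 1 => ‖Q v‖ ^ 2) μ :=
    hint (g := fun v => ‖Q v‖ ^ 2) (by fun_prop)
  have hP2 : Integrable (fun v : sphere (0 : V) 1 => ‖P v‖ ^ 2) μ :=
    hint (g := fun v => ‖P v‖ ^ 2) (by fun_prop)
  have hQP : Integrable (fun v : sphere (0 : V) 1 =>
      ((Module.finrank ℝ V : ℝ) + 2 * d - 4) * ‖Q v‖ ^ 2 + ‖P v‖ ^ 2) μ := (hQ2.const_mul _).add hP2
  simp_rw [wedgePairing_eq B hB hP hQ h hPf]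
  rw [integral_sub hQP (integrable_finsetSum _ fun i _ => hi i),
    integral_add (hQ2.const_mul _) hP2, integral_finsetSum _ fun i _ => hi i,
    Finset.sum_eq_zero, integral_const_mul, sub_zero]
  · simp_rw [hPf, hQf]
  · intro i _
    -- The degrees are $d-2$ and $d$, hence distinct.
    exact integral_sphere_inner_eq_zero (by omega) (hQ.fderiv _)
      (hP.clm_comp (B (stdOrthonormalBasis ℝ V i)))

end FibreIdentity

/-! ### Continuity and linearity of integrals over one sphere -/

section Integrability

variable {V : Type*} [NormedAddCommGroup V] [InnerProductSpace ℝ V] [FiniteDimensional ℝ V]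

theorem integrable_sphere [MeasurableSpace V] [BorelSpace V] {g : sphere (0 : V) 1 → ℝ}
    (hg : Continuous g) : Integrable g (volume : Measure V).toSphere :=
  hg.integrable_of_hasCompactSupport (HasCompactSupport.of_compactSpace _)

theorem sphereIntegral_add {g h : sphere (0 : V) 1 → ℝ} (hg : Continuous g) (hh : Continuous h) :
    sphereIntegral (fun v => g v + h v) = sphereIntegral g + sphereIntegral h := by
  let _ : MeasurableSpace V := borel V
  have : BorelSpace V := ⟨rfl⟩
  simp only [sphereIntegral_eq]
  exact integral_add (integrable_sphere hg) (integrable_sphere hh)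

theorem sphereIntegral_const_mul (c : ℝ) (g : sphere (0 : V) 1 → ℝ) :
    sphereIntegral (fun v => c * g v) = c * sphereIntegral g := by
  let _ : MeasurableSpace V := borel V
  have : BorelSpace V := ⟨rfl⟩
  simp only [sphereIntegral_eq]
  exact integral_const_mul c g

variable {W : Type*} [NormedAddCommGroup W] [InnerProductSpace ℝ W] [FiniteDimensional ℝ W]
variable {U : Type*} [NormedAddCommGroup U] [InnerProductSpace ℝ U]

theorem IsSphericalHarmonic.continuous {W : Type*} [NormedAddCommGroup W] [NormedSpace ℝ W] {d : ℤ}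
    {f : sphere (0 : V) 1 → W} (hf : IsSphericalHarmonic d f) : Continuous f := by
  obtain ⟨P, hP, -, -, h⟩ := hf
  rw [← funext h]
  exact hP.continuous.comp continuous_subtype_val

theorem continuous_wedgePairing (B : V →L[ℝ] W →L[ℝ] U) {d : ℤ}
    {f : sphere (0 : V) 1 → W} (hf : IsSphericalHarmonic d f) : Continuous (wedgePairing B f) := by
  obtain ⟨P, hP, hPf⟩ := isSphericalHarmonic_iff.1 hf
  have hfc := hf.continuous
  have hg : ∀ α, Continuous fun v : sphere (0 : V) 1 =>
      sphereGrad (fun w => ⟪f w, stdOrthonormalBasis ℝ W α⟫_ℝ) v := by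
    intro α
    have hp : IsSolidHarmonic d fun w => innerSL ℝ (stdOrthonormalBasis ℝ W α) (P w) :=
      hP.clm_comp _
    have e : (fun v : sphere (0 : V) 1 =>
        sphereGrad (fun w => ⟪f w, stdOrthonormalBasis ℝ W α⟫_ℝ) v) =
        fun v : sphere (0 : V) 1 => ∑ i, (fderiv ℝ (fun w => innerSL ℝ (stdOrthonormalBasis ℝ W α) (P w)) v
          (stdOrthonormalBasis ℝ V i) - d * ⟪(v : V), stdOrthonormalBasis ℝ V i⟫_ℝ *
          innerSL ℝ (stdOrthonormalBasis ℝ W α) (P v)) • stdOrthonormalBasis ℝ V i := by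
      funext v
      rw [← (stdOrthonormalBasis ℝ V).sum_repr'
        (sphereGrad (fun w => ⟪f w, stdOrthonormalBasis ℝ W α⟫_ℝ) v)]
      refine Finset.sum_congr rfl fun i _ => ?_
      rw [real_inner_comm, inner_sphereGrad hp.differentiable hp.homog
        (fun w => by rw [hPf w, innerSL_apply_apply, real_inner_comm])]
    rw [e]
    refine continuous_finsetSum _ fun i _ => Continuous.smul (Continuous.sub ?_ ?_)
      continuous_const
    · exact (hp.fderiv _).contDiff.continuous.comp continuous_subtype_val
    · have := hP.contDiff.continuous
      fun_prop
  unfold wedgePairing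
  refine continuous_finsetSum _ fun α _ => ?_
  have := hg α
  fun_prop

end Integrability

/-! ### Reduction of the complex hyperbolic curvature to wedge pairings -/

section HyperbolicCurvature

variable {V : Type*} [NormedAddCommGroup V] [InnerProductSpace ℝ V] [FiniteDimensional ℝ V]
  {J : V →ₗ[ℝ] V}

theorem inner_complexStructure_left (hJ : ∀ v, J (J v) = -v) (hJi : ∀ v w, ⟪J v, J w⟫_ℝ = ⟪v, w⟫_ℝ)
    (v w : V) : ⟪J v, w⟫_ℝ = -⟪v, J w⟫_ℝ := by
  rw [← hJi (J v) w, hJ, inner_neg_left]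

theorem inner_complexStructure_self (hJ : ∀ v, J (J v) = -v) (hJi : ∀ v w, ⟪J v, J w⟫_ℝ = ⟪v, w⟫_ℝ)
    (v : V) : ⟪v, J v⟫_ℝ = 0 := by
  have := inner_complexStructure_left hJ hJi v v
  rw [real_inner_comm] at this
  linarith

/-- An orthogonal complex structure as a linear isometry. -/
def isometryOfOrthogonal (J : V →ₗ[ℝ] V) (hJ : ∀ v, J (J v) = -v)
    (hJi : ∀ v w, ⟪J v, J w⟫_ℝ = ⟪v, w⟫_ℝ) : V ≃ₗᵢ[ℝ] V :=
  LinearEquiv.isometryOfInner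
    (LinearEquiv.ofLinearMap J (-J) (by ext; simp [hJ]) (by ext; simp [hJ])) hJi

/-! ### Values in the tangent space -/

/-- The contraction `(w, a) ↦ ⟨K w, a⟩`. -/
def innerContraction (K : V →ₗ[ℝ] V) : V →L[ℝ] V →L[ℝ] ℝ :=
  (innerSL ℝ).comp K.toContinuousLinearMap

theorem innerContraction_apply (K : V →ₗ[ℝ] V) (v w : V) : innerContraction K v w = ⟪K v, w⟫_ℝ :=
  rfl

theorem sum_innerContraction_sq {ι : Type*} [Fintype ι] (b : OrthonormalBasis ι ℝ V) (w : V) :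
    ∑ i, ‖innerContraction LinearMap.id (b i) w‖ ^ 2 = ‖w‖ ^ 2 :=
  b.sum_sq_norm_inner_right w

theorem sum_innerContraction_map_sq (hJ : ∀ v, J (J v) = -v)
    (hJi : ∀ v w, ⟪J v, J w⟫_ℝ = ⟪v, w⟫_ℝ) {ι : Type*} [Fintype ι] (b : OrthonormalBasis ι ℝ V)
    (w : V) : ∑ i, ‖innerContraction J (b i) w‖ ^ 2 = ‖w‖ ^ 2 :=
  (b.map (isometryOfOrthogonal J hJ hJi)).sum_sq_norm_inner_right w

/-- The two wedges are the pairings for $K = \mathrm{id}$ and $K = J$. In the remaining term, moving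
$J$ from $f$ to $e_\alpha$ changes the sign and produces $+\tfrac12$. -/
theorem curvPairing_hypTensor (hJ : ∀ v, J (J v) = -v) (hJi : ∀ v w, ⟪J v, J w⟫_ℝ = ⟪v, w⟫_ℝ)
    (f : sphere (0 : V) 1 → V) (v : sphere (0 : V) 1) :
    curvPairing (hypTensor J) f v =
      (1 / 4 : ℝ) * (wedgePairing (innerContraction LinearMap.id) f v +
        wedgePairing (innerContraction J) f v) + (1 / 2 : ℝ) * crossTerm J f v := by
  simp only [curvPairing, wedgePairing, crossTerm, ← Finset.sum_add_distrib, Finset.mul_sum]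
  refine Finset.sum_congr rfl fun α _ => ?_
  generalize sphereGrad (fun w => ⟪f w, stdOrthonormalBasis ℝ V α⟫_ℝ) v = Y
  generalize stdOrthonormalBasis ℝ V α = e
  have h1 := inner_complexStructure_left hJ hJi (f v) e
  simp only [hypTensor, hypCurv, wedgeEnd, innerContraction_apply, LinearMap.smul_apply,
    LinearMap.sub_apply, LinearMap.add_apply, LinearMap.smulRight_apply, innerₛₗ_apply_apply,
    inner_sub_left, inner_add_left, real_inner_smul_left, LinearMap.id_apply, RCLike.inner_apply,
    conj_trivial, h1]
  ring

/-- As $Jv$ is tangent to the sphere, the gradients sum to the plain derivative of $P$ along $Jv$;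
the two signs from the skewness of $J$ cancel. -/
theorem crossTerm_eq (hJ : ∀ v, J (J v) = -v) (hJi : ∀ v w, ⟪J v, J w⟫_ℝ = ⟪v, w⟫_ℝ) {d : ℤ}
    {P : V → V} (hP : IsSolidHarmonic d P) {f : sphere (0 : V) 1 → V}
    (hPf : ∀ v : sphere (0 : V) 1, P v = f v) (v : sphere (0 : V) 1) :
    crossTerm J f v = ⟪J (P v), fderiv ℝ P v (J v)⟫_ℝ := by
  have h := sum_inner_sphereGrad_smul hP.differentiable hP.homog hPf v (J v)
  rw [inner_complexStructure_self hJ hJi, mul_zero, zero_smul, sub_zero] at h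
  rw [← h, inner_sum, crossTerm]
  refine Finset.sum_congr rfl fun α _ => ?_
  have h1 : ∀ Y : V, ⟪(v : V), J Y⟫_ℝ = -⟪Y, J v⟫_ℝ := fun Y => by
    rw [real_inner_comm, inner_complexStructure_left hJ hJi]
  rw [real_inner_smul_right, h1, inner_complexStructure_left hJ hJi (P v), hPf]
  ring

/-- The polynomial $P$ is chosen fibre by fibre, with no control in the base point. Expressing the
cross term through $f$ itself allows its continuity over $M$ to be deduced. -/
theorem crossTerm_eq_fderiv_radialExt (hJ : ∀ v, J (J v) = -v)
    (hJi : ∀ v w, ⟪J v, J w⟫_ℝ = ⟪v, w⟫_ℝ) {d : ℤ} {f : sphere (0 : V) 1 → V}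
    (hf : IsSphericalHarmonic d f) (v : sphere (0 : V) 1) :
    crossTerm J f v = ⟪J (f v), fderiv ℝ (radialExt f) v (J v)⟫_ℝ := by
  obtain ⟨P, hP, hPf⟩ := isSphericalHarmonic_iff.1 hf
  rw [crossTerm_eq hJ hJi hP hPf, (hasFDerivAt_radialExt hP.differentiable hP.homog hPf v).fderiv,
    hPf]
  simp [inner_complexStructure_self hJ hJi]

theorem continuous_crossTerm (hJ : ∀ v, J (J v) = -v) (hJi : ∀ v w, ⟪J v, J w⟫_ℝ = ⟪v, w⟫_ℝ)
    {d : ℤ} {f : sphere (0 : V) 1 → V} (hf : IsSphericalHarmonic d f) :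
    Continuous (crossTerm J f) := by
  obtain ⟨P, hP, hPf⟩ := isSphericalHarmonic_iff.1 hf
  rw [funext (crossTerm_eq hJ hJi hP hPf)]
  have hJc : Continuous J := J.continuous_of_finiteDimensional
  have h1 : Continuous (fderiv ℝ P) := hP.contDiff.continuous_fderiv (by simp)
  have h2 := hP.contDiff.continuous
  exact (by fun_prop : Continuous fun v : V => ⟪J (P v), fderiv ℝ P v (J v)⟫_ℝ).comp
    continuous_subtype_val

/-- The integrated curvature identity on one tangent space, for values in the tangent space. -/
theorem sphereIntegral_curvPairing_hypTensor (hJ : ∀ v, J (J v) = -v)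
    (hJi : ∀ v w, ⟪J v, J w⟫_ℝ = ⟪v, w⟫_ℝ) {d : ℤ} {f : sphere (0 : V) 1 → V}
    (hf : IsSphericalHarmonic d f) (h1 : IsSphericalHarmonic (d - 1) (iotaV f))
    (h2 : IsSphericalHarmonic (d - 1) (iotaJV J f)) :
    sphereIntegral (curvPairing (hypTensor J) f) =
      (1 / 4 : ℝ) * ((Module.finrank ℝ V : ℝ) + 2 * d - 4) *
        (sphereIntegral (fun v => ‖iotaV f v‖ ^ 2) +
          sphereIntegral (fun v => ‖iotaJV J f v‖ ^ 2)) +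
      (1 / 2 : ℝ) * sphereIntegral (fun v => ‖f v‖ ^ 2) +
      (1 / 2 : ℝ) * sphereIntegral (crossTerm J f) := by
  have e1 := sphereIntegral_wedgePairing (innerContraction LinearMap.id)
    (sum_innerContraction_sq _) hf h1
  have e2 := sphereIntegral_wedgePairing (innerContraction J)
    (sum_innerContraction_map_sq hJ hJi _) hf h2
  have c1 := continuous_wedgePairing (innerContraction LinearMap.id) hf
  have c2 := continuous_wedgePairing (innerContraction J) hf
  have c3 := continuous_crossTerm hJ hJi hf
  rw [funext (curvPairing_hypTensor hJ hJi f), sphereIntegral_add (by fun_prop) (by fun_prop),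
    sphereIntegral_const_mul, sphereIntegral_const_mul, sphereIntegral_add c1 c2, e1, e2]
  simp only [iotaV, iotaJV, innerContraction_apply, LinearMap.id_apply]
  ring

/-! ### Values in the symmetric endomorphisms -/

theorem traceInner_eq_sum {ι : Type*} [Fintype ι] (b : OrthonormalBasis ι ℝ V)
    (A B : V →ₗ[ℝ] V) : traceInner A B = ∑ i, ⟪A (b i), B (b i)⟫_ℝ := by
  rw [traceInner, LinearMap.trace_eq_sum_inner _ b]
  simp only [LinearMap.comp_apply, LinearMap.adjoint_inner_right]

theorem traceInner_add_left (A A' B : V →ₗ[ℝ] V) :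
    traceInner (A + A') B = traceInner A B + traceInner A' B := by
  simp [traceInner, LinearMap.add_comp]

theorem traceInner_sub_left (A A' B : V →ₗ[ℝ] V) :
    traceInner (A - A') B = traceInner A B - traceInner A' B := by
  simp [traceInner, LinearMap.sub_comp]

theorem traceInner_smul_left (c : ℝ) (A B : V →ₗ[ℝ] V) :
    traceInner (c • A) B = c * traceInner A B := by
  simp [traceInner, LinearMap.smul_comp]

theorem traceInner_smulRight (a c : V) (B : V →ₗ[ℝ] V) :
    traceInner ((innerₛₗ ℝ a).smulRight c) B = ⟪c, B a⟫_ℝ := by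
  set b := stdOrthonormalBasis ℝ V
  rw [traceInner_eq_sum b]
  conv_rhs => rw [← b.sum_repr' a, map_sum, inner_sum]
  refine Finset.sum_congr rfl fun i _ => ?_
  simp [real_inner_smul_left, real_inner_smul_right, real_inner_comm a]

theorem norm_symEnd_sq {ι : Type*} [Fintype ι] (b : OrthonormalBasis ι ℝ V) (A : symEnd V) :
    ‖A‖ ^ 2 = ∑ i, ‖A.1 (b i)‖ ^ 2 := by
  rw [← real_inner_self_eq_norm_sq]
  refine (traceInner_eq_sum b A.1 A.1).trans ?_
  simp only [real_inner_self_eq_norm_sq]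

/-- The contraction `(w, A) ↦ A (K w)`. -/
def symContraction (K : V →ₗ[ℝ] V) : V →L[ℝ] symEnd V →L[ℝ] V :=
  ((symEnd V).subtype.flip ∘ₗ K).toContinuousBilinearMap

theorem symContraction_apply (K : V →ₗ[ℝ] V) (v : V) (A : symEnd V) :
    symContraction K v A = A.1 (K v) := rfl

theorem sum_symContraction_sq {ι : Type*} [Fintype ι] (b : OrthonormalBasis ι ℝ V) (A : symEnd V) :
    ∑ i, ‖symContraction LinearMap.id (b i) A‖ ^ 2 = ‖A‖ ^ 2 :=
  (norm_symEnd_sq b A).symm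

theorem sum_symContraction_map_sq (hJ : ∀ v, J (J v) = -v)
    (hJi : ∀ v w, ⟪J v, J w⟫_ℝ = ⟪v, w⟫_ℝ) {ι : Type*} [Fintype ι] (b : OrthonormalBasis ι ℝ V)
    (A : symEnd V) : ∑ i, ‖symContraction J (b i) A‖ ^ 2 = ‖A‖ ^ 2 :=
  (norm_symEnd_sq (b.map (isometryOfOrthogonal J hJ hJi)) A).symm

/-- For symmetric $A$ both products are differences of rank-one maps; symmetry of $B$ makes their
contributions equal up to sign, whence the factor $2$. -/
theorem traceInner_commutator_wedgeEnd (X Y : V) (A B : symEnd V) :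
    traceInner (wedgeEnd X Y ∘ₗ A.1 - A.1 ∘ₗ wedgeEnd X Y) B.1 =
      2 * (⟪B.1 Y, A.1 X⟫_ℝ - ⟪B.1 X, A.1 Y⟫_ℝ) := by
  have hA : A.1.IsSymmetric := A.2
  have hB : B.1.IsSymmetric := B.2
  have e1 : wedgeEnd X Y ∘ₗ A.1 =
      (innerₛₗ ℝ (A.1 X)).smulRight Y - (innerₛₗ ℝ (A.1 Y)).smulRight X := by
    ext Z
    simp [wedgeEnd, hA X Z, hA Y Z]
  have e2 : A.1 ∘ₗ wedgeEnd X Y =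
      (innerₛₗ ℝ X).smulRight (A.1 Y) - (innerₛₗ ℝ Y).smulRight (A.1 X) := by
    ext Z
    simp [wedgeEnd]
  rw [e1, e2]
  simp only [traceInner_sub_left, traceInner_smulRight]
  rw [← hB Y, ← hB X, real_inner_comm (B.1 X), real_inner_comm (B.1 Y)]
  ring

theorem hypTensorSym_eq (X Y : V) (A B : symEnd V) (hA : J ∘ₗ A.1 - A.1 ∘ₗ J = 0) :
    hypTensorSym J X Y A B = (1 / 2 : ℝ) * ((⟪B.1 Y, A.1 X⟫_ℝ - ⟪B.1 X, A.1 Y⟫_ℝ) +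
      (⟪B.1 (J Y), A.1 (J X)⟫_ℝ - ⟪B.1 (J X), A.1 (J Y)⟫_ℝ)) := by
  have e : hypCurv J X Y ∘ₗ A.1 - A.1 ∘ₗ hypCurv J X Y =
      (1 / 4 : ℝ) • ((wedgeEnd X Y ∘ₗ A.1 - A.1 ∘ₗ wedgeEnd X Y) +
        (wedgeEnd (J X) (J Y) ∘ₗ A.1 - A.1 ∘ₗ wedgeEnd (J X) (J Y))) := by
    have h0 : (1 / 4 * (2 * ⟪X, J Y⟫_ℝ)) • (J ∘ₗ A.1 - A.1 ∘ₗ J) = 0 := by rw [hA, smul_zero]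
    rw [hypCurv, LinearMap.smul_comp, LinearMap.comp_smul, LinearMap.sub_comp, LinearMap.add_comp,
      LinearMap.comp_sub, LinearMap.comp_add, LinearMap.smul_comp, LinearMap.comp_smul, ← sub_eq_zero,
      ← neg_eq_zero, ← h0]
    module
  rw [hypTensorSym, e, traceInner_smul_left, traceInner_add_left, traceInner_commutator_wedgeEnd,
    traceInner_commutator_wedgeEnd]
  ring

theorem curvPairing_hypTensorSym {f : sphere (0 : V) 1 → symEnd V} (v : sphere (0 : V) 1)
    (hf : J ∘ₗ (f v).1 - (f v).1 ∘ₗ J = 0) :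
    curvPairing (hypTensorSym J) f v =
      (1 / 2 : ℝ) * (wedgePairing (symContraction LinearMap.id) f v +
        wedgePairing (symContraction J) f v) := by
  simp only [curvPairing, wedgePairing, ← Finset.sum_add_distrib, Finset.mul_sum]
  exact Finset.sum_congr rfl fun α _ => hypTensorSym_eq _ _ _ _ hf

/-- Commutation gives $f(Jv) = J(f v)$, and $J$ is an isometry. -/
theorem norm_iotaJVSym (hJi : ∀ v w, ⟪J v, J w⟫_ℝ = ⟪v, w⟫_ℝ) {f : sphere (0 : V) 1 → symEnd V}
    (v : sphere (0 : V) 1) (hf : J ∘ₗ (f v).1 - (f v).1 ∘ₗ J = 0) :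
    ‖iotaJVSym J f v‖ = ‖iotaVSym f v‖ := by
  have h := congrArg (fun L => L (v : V)) (sub_eq_zero.1 hf)
  simp only [LinearMap.comp_apply] at h
  rw [iotaJVSym, iotaVSym, ← h]
  have h2 := hJi ((f v).1 v) ((f v).1 v)
  rw [real_inner_self_eq_norm_sq, real_inner_self_eq_norm_sq] at h2
  exact (sq_eq_sq₀ (norm_nonneg _) (norm_nonneg _)).1 h2

/-- The integrated curvature identity on one tangent space, for values in the symmetric
endomorphisms. -/
theorem sphereIntegral_curvPairing_hypTensorSym (hJ : ∀ v, J (J v) = -v)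
    (hJi : ∀ v w, ⟪J v, J w⟫_ℝ = ⟪v, w⟫_ℝ) {d : ℤ} {f : sphere (0 : V) 1 → symEnd V}
    (hf : IsSphericalHarmonic d f) (h1 : IsSphericalHarmonic (d - 1) (iotaVSym f))
    (h2 : IsSphericalHarmonic (d - 1) (iotaJVSym J f))
    (hc : ∀ v, J ∘ₗ (f v).1 - (f v).1 ∘ₗ J = 0) :
    sphereIntegral (curvPairing (hypTensorSym J) f) =
      ((Module.finrank ℝ V : ℝ) + 2 * d - 4) * sphereIntegral (fun v => ‖iotaVSym f v‖ ^ 2) +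
        sphereIntegral (fun v => ‖f v‖ ^ 2) := by
  have e1 := sphereIntegral_wedgePairing (symContraction LinearMap.id)
    (sum_symContraction_sq _) hf h1
  have e2 := sphereIntegral_wedgePairing (symContraction J)
    (sum_symContraction_map_sq hJ hJi _) hf h2
  have c1 := continuous_wedgePairing (symContraction LinearMap.id) hf
  have c2 := continuous_wedgePairing (symContraction J) hf
  have e3 : sphereIntegral (fun v => ‖symContraction J v (f v)‖ ^ 2) =
      sphereIntegral (fun v => ‖iotaVSym f v‖ ^ 2) :=
    congrArg sphereIntegral (funext fun v => congrArg (· ^ 2) (norm_iotaJVSym hJi v (hc v)))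
  rw [show curvPairing (hypTensorSym J) f = _ from
    funext fun v => curvPairing_hypTensorSym v (hc v), sphereIntegral_const_mul,
    sphereIntegral_add c1 c2, e1, e2, e3]
  simp only [iotaVSym, symContraction_apply, LinearMap.id_apply]
  ring

end HyperbolicCurvature

/-! ### Finiteness of the Riemannian measure -/

section RiemannianMeasure

variable {n : ℕ} {M : Type*} [TopologicalSpace M] [ChartedSpace (EuclideanSpace ℝ (Fin n)) M]
  [IsManifold (𝓡 n) ∞ M] [Bundle.RiemannianBundle (fun x : M => TangentSpace (𝓡 n) x)]

theorem isContinuousRiemannianBundle_of_isContMDiff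
    [h : IsContMDiffRiemannianBundle (𝓡 n) ∞ (EuclideanSpace ℝ (Fin n))
      (fun x : M => TangentSpace (𝓡 n) x)] :
    IsContinuousRiemannianBundle (EuclideanSpace ℝ (Fin n))
      (fun x : M => TangentSpace (𝓡 n) x) := by
  obtain ⟨g, hg, hgi⟩ := h.exists_contMDiff
  exact ⟨g, hg.continuous, hgi⟩

variable [IsContinuousRiemannianBundle (EuclideanSpace ℝ (Fin n))
      (fun x : M => TangentSpace (𝓡 n) x)]

theorem continuousOn_mfderiv_chart_symm (x₀ : M) (e : EuclideanSpace ℝ (Fin n)) :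
    ContinuousOn (fun y : EuclideanSpace ℝ (Fin n) =>
      (⟨(chartAt (EuclideanSpace ℝ (Fin n)) x₀).symm y,
        mfderiv (𝓡 n) (𝓡 n) (chartAt (EuclideanSpace ℝ (Fin n)) x₀).symm y e⟩ :
        TangentBundle (𝓡 n) M)) (chartAt (EuclideanSpace ℝ (Fin n)) x₀).target := by
  have ho := (chartAt (EuclideanSpace ℝ (Fin n)) x₀).open_target
  have h1 := (contMDiffOn_chart_symm (I := 𝓡 n) (n := ∞) (x := x₀)).continuousOn_tangentMapWithin
    (by simp) ho.uniqueMDiffOn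
  have h2 : Continuous fun y : EuclideanSpace ℝ (Fin n) =>
      (⟨y, e⟩ : TangentBundle (𝓡 n) (EuclideanSpace ℝ (Fin n))) := by
    have h3 := (tangentBundleModelSpaceHomeomorph (𝓡 n)).symm.continuous.comp
      (continuous_id.prodMk (continuous_const (y := e)) :
        Continuous fun y : EuclideanSpace ℝ (Fin n) => (y, e))
    exact h3
  refine (h1.comp h2.continuousOn fun y hy => hy).congr fun y hy => ?_
  simp only [Function.comp_apply, tangentMapWithin]
  rw [mfderivWithin_of_isOpen ho hy]

theorem continuousOn_chartGram (x₀ : M) :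
    ContinuousOn (chartGram n x₀) (chartAt (EuclideanSpace ℝ (Fin n)) x₀).target := by
  refine continuousOn_pi.2 fun i => continuousOn_pi.2 fun j => ?_
  exact (continuousOn_mfderiv_chart_symm x₀ _).inner_bundle (continuousOn_mfderiv_chart_symm x₀ _)

variable [MeasurableSpace M] [BorelSpace M]

/-- The density $\sqrt{\det g_{ij}}$ is continuous on the chart target, hence bounded on the compact
image of $K$, which has finite Lebesgue measure. -/
theorem chartMeasure_lt_top_of_isCompact [T2Space M] (x₀ : M) {K : Set M} (hK : IsCompact K)
    (hKs : K ⊆ (chartAt (EuclideanSpace ℝ (Fin n)) x₀).source) : chartMeasure n x₀ K < ⊤ := by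
  set φ := chartAt (EuclideanSpace ℝ (Fin n)) x₀ with hφ
  set ν := ((volume : Measure (EuclideanSpace ℝ (Fin n))).restrict φ.target).withDensity
      fun y => ENNReal.ofReal (Real.sqrt (chartGram n x₀ y).det) with hν
  have hKc : IsCompact (φ '' K) := hK.image_of_continuousOn (φ.continuousOn.mono hKs)
  have hKt : φ '' K ⊆ φ.target := by
    rintro _ ⟨x, hx, rfl⟩
    exact φ.map_source (hKs hx)
  by_cases hm : AEMeasurable φ.symm ν
  swap
  -- The push-forward along a map that is not a.e. measurable is zero by convention.
  · rw [chartMeasure, Measure.map_of_not_aemeasurable hm]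
    simp
  have hd : ContinuousOn (fun y => Real.sqrt (chartGram n x₀ y).det) φ.target :=
    Real.continuous_sqrt.comp_continuousOn
      ((continuous_id.matrix_det).comp_continuousOn (continuousOn_chartGram x₀))
  obtain ⟨C, hC⟩ := hKc.exists_bound_of_continuousOn (hd.mono hKt)
  have hms : MeasurableSet (φ.target ∩ φ.symm ⁻¹' K) := by
    have : φ.target ∩ φ.symm ⁻¹' K = φ '' K := by
      rw [φ.image_eq_target_inter_inv_preimage hKs]
    rw [this]
    exact hKc.isClosed.measurableSet
  -- Off the target the values of `φ.symm` are arbitrary and may lie in $K$; that region is null for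
  -- $\nu$.
  have hle : φ.symm ⁻¹' K ⊆ φ '' K ∪ φ.targetᶜ := by
    intro y hy
    by_cases hyt : y ∈ φ.target
    · exact Or.inl ⟨φ.symm y, hy, φ.right_inv hyt⟩
    · exact Or.inr hyt
  rw [chartMeasure, Measure.map_apply_of_aemeasurable hm hK.isClosed.measurableSet]
  have hz : ν φ.targetᶜ = 0 := by
    refine withDensity_absolutelyContinuous _ _ ?_
    rw [Measure.restrict_apply φ.open_target.measurableSet.compl]
    simp
  calc ν (φ.symm ⁻¹' K) ≤ ν (φ '' K) + ν φ.targetᶜ := (measure_mono hle).trans (measure_union_le _ _)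
    _ = ∫⁻ y in φ '' K, ENNReal.ofReal (Real.sqrt (chartGram n x₀ y).det)
        ∂((volume : Measure (EuclideanSpace ℝ (Fin n))).restrict φ.target) := by
      rw [hz, add_zero, hν, withDensity_apply _ hKc.isClosed.measurableSet]
    _ ≤ ∫⁻ y in φ '' K, ENNReal.ofReal C
        ∂((volume : Measure (EuclideanSpace ℝ (Fin n))).restrict φ.target) := by
      refine setLIntegral_mono' hKc.isClosed.measurableSet fun y hy => ENNReal.ofReal_le_ofReal ?_
      exact (le_abs_self _).trans (hC y hy)
    _ < ⊤ := by
      rw [setLIntegral_const]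
      refine ENNReal.mul_lt_top ENNReal.ofReal_lt_top ?_
      exact (Measure.restrict_apply_le _ _).trans_lt hKc.measure_lt_top

variable (n M) in
-- By local finiteness and compactness only finitely many partition functions are nonzero, and each
-- has compact support inside its chart domain.
theorem isFiniteMeasure_riemannianMeasure [T2Space M] [CompactSpace M] :
    IsFiniteMeasure (riemannianMeasure n M) := by
  constructor
  set ρ := chartPartition n M
  have hsub : ∀ i : M, tsupport (ρ i) ⊆ (chartAt (EuclideanSpace ℝ (Fin n)) i).source :=
    (SmoothPartitionOfUnity.exists_isSubordinate_chartAt_source (𝓡 n) M).choose_spec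
  have hfin := ρ.locallyFinite'.finite_nonempty_of_compact
  rw [riemannianMeasure, Measure.sum_apply _ MeasurableSet.univ,
    tsum_eq_sum (s := hfin.toFinset)]
  · refine ENNReal.sum_lt_top.2 fun i _ => ?_
    rw [withDensity_apply _ MeasurableSet.univ, Measure.restrict_univ]
    have hK : IsCompact (tsupport (ρ i)) := (isClosed_tsupport _).isCompact
    calc ∫⁻ x, ENNReal.ofReal (ρ i x) ∂(chartMeasure n i)
        ≤ ∫⁻ x, (tsupport (ρ i)).indicator 1 x ∂(chartMeasure n i) := by
          refine lintegral_mono fun x => ?_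
          by_cases hx : x ∈ tsupport (ρ i)
          · simpa [hx] using ρ.le_one i x
          · simp [hx, image_eq_zero_of_notMem_tsupport hx]
      _ = chartMeasure n i (tsupport (ρ i)) := by
          rw [lintegral_indicator_one hK.isClosed.measurableSet]
      _ < ⊤ := chartMeasure_lt_top_of_isCompact i hK (hsub i)
  · intro i hi
    have h0 : ∀ x, ρ i x = 0 := fun x => by
      by_contra hx
      exact hi (hfin.mem_toFinset.2 ⟨x, hx⟩)
    have : (fun x => ENNReal.ofReal (ρ i x)) = 0 := by
      funext x
      simp [h0 x]
    rw [this, withDensity_zero]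
    rfl

end RiemannianMeasure

/-! ### Isometry invariance of the spherical integral -/

section SphereIsometry

variable {V V' : Type*} [NormedAddCommGroup V] [InnerProductSpace ℝ V] [FiniteDimensional ℝ V]
  [NormedAddCommGroup V'] [InnerProductSpace ℝ V'] [FiniteDimensional ℝ V']

/-- The homeomorphism of unit spheres induced by a linear isometry. -/
def sphereHomeomorph (L : V ≃ₗᵢ[ℝ] V') : sphere (0 : V) 1 ≃ₜ sphere (0 : V') 1 where
  toFun v := ⟨L v, by simp⟩
  invFun v := ⟨L.symm v, by simp⟩
  left_inv v := by ext; simp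
  right_inv v := by ext; simp
  continuous_toFun := by fun_prop
  continuous_invFun := by fun_prop

theorem coe_sphereHomeomorph (L : V ≃ₗᵢ[ℝ] V') (v : sphere (0 : V) 1) :
    (sphereHomeomorph L v : V') = L v := rfl

/-- The surface measure of a set is the dimension times the volume of the cone over it, and a linear
isometry preserves both. -/
theorem map_toSphere_sphereHomeomorph [MeasurableSpace V] [BorelSpace V] [MeasurableSpace V']
    [BorelSpace V'] (L : V ≃ₗᵢ[ℝ] V') :
    Measure.map (sphereHomeomorph L) (volume : Measure V).toSphere =
      (volume : Measure V').toSphere := by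
  ext s hs
  have hm := (sphereHomeomorph L).measurable hs
  rw [Measure.map_apply (sphereHomeomorph L).measurable hs, Measure.toSphere_apply' _ hm,
    Measure.toSphere_apply' _ hs, L.toLinearEquiv.finrank_eq,
    ← L.measurePreserving.measure_preimage_equiv (f := L.toHomeomorph.toMeasurableEquiv)]
  congr 2
  ext x
  simp only [Set.mem_smul, Set.mem_image, Set.mem_preimage, Homeomorph.toMeasurableEquiv_coe]
  constructor
  · rintro ⟨t, ht, _, ⟨v, hv, rfl⟩, rfl⟩
    exact ⟨t, ht, _, ⟨_, hv, rfl⟩, by simp [coe_sphereHomeomorph]⟩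
  · rintro ⟨t, ht, _, ⟨v, hv, rfl⟩, h⟩
    refine ⟨t, ht, _, ⟨(sphereHomeomorph L).symm v, by simpa using hv, rfl⟩, L.injective ?_⟩
    rw [map_smul, ← coe_sphereHomeomorph, Homeomorph.apply_symm_apply]
    exact h

theorem sphereIntegral_comp_isometry (L : V ≃ₗᵢ[ℝ] V') (F : sphere (0 : V') 1 → ℝ) :
    sphereIntegral F = sphereIntegral fun v => F (sphereHomeomorph L v) := by
  let _ : MeasurableSpace V := borel V
  have : BorelSpace V := ⟨rfl⟩
  let _ : MeasurableSpace V' := borel V'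
  have : BorelSpace V' := ⟨rfl⟩
  rw [sphereIntegral_eq, sphereIntegral_eq, ← map_toSphere_sphereHomeomorph L,
    (sphereHomeomorph L).measurableEmbedding.integral_map]

end SphereIsometry

/-! ### Continuous orthonormal frames and fibre integration -/

section OrthonormalFrame

open Bundle

variable {B : Type*} [TopologicalSpace B] {F : Type*} [NormedAddCommGroup F] [NormedSpace ℝ F]
  {E : B → Type*} [TopologicalSpace (TotalSpace F E)] [∀ x, NormedAddCommGroup (E x)]
  [∀ x, InnerProductSpace ℝ (E x)] [FiberBundle F E] [VectorBundle ℝ F E]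
  (e : Trivialization F (π F E)) [e.IsLinear ℝ]

theorem continuousOn_section_iff {X : Type*} [TopologicalSpace X] {S : Set X} {p : X → B}
    (hp : ContinuousOn p S) (hpS : Set.MapsTo p S e.baseSet) (s : ∀ a, E (p a)) :
    ContinuousOn (fun a => (⟨p a, s a⟩ : TotalSpace F E)) S ↔
      ContinuousOn (fun a => e.continuousLinearMapAt ℝ (p a) (s a)) S := by
  constructor
  · intro h
    have h1 : ContinuousOn (fun a => (e ⟨p a, s a⟩).2) S :=
      (e.continuousOn.comp h fun a ha => e.mem_source.2 (hpS ha)).snd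
    refine h1.congr fun a ha => ?_
    rw [e.continuousLinearMapAt_apply ℝ, e.coe_linearMapAt_of_mem (hpS ha)]
  · intro h
    refine (e.continuousOn_symm.comp (hp.prodMk h) fun a ha => ⟨hpS ha, Set.mem_univ _⟩).congr
      fun a ha => ?_
    simp only [Function.comp_apply]
    rw [← e.symmL_apply (R := ℝ) (hpS ha), e.symmL_continuousLinearMapAt (hpS ha)]

variable {m : ℕ} (b : Module.Basis (Fin m) ℝ F)

/-- The frame of a trivialization over its base set. -/
def trivFrame (x : B) (i : Fin m) : E x := e.symmL ℝ x (b i)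

theorem linearIndependent_trivFrame {x : B} (hx : x ∈ e.baseSet) :
    LinearIndependent ℝ (trivFrame e b x) :=
  b.linearIndependent.map' (e.symmL ℝ x).toLinearMap <| LinearMap.ker_eq_bot.2 fun u w h => by
    have := congrArg (e.continuousLinearMapAt ℝ x) h
    simpa [e.continuousLinearMapAt_symmL hx] using this

variable [IsContinuousRiemannianBundle F E]

/-- Strong induction along the Gram–Schmidt recursion; the denominators do not vanish because the
frame is independent over the base set. -/
theorem continuousOn_gramSchmidt_trivFrame (i : Fin m) :
    ContinuousOn (fun x => (⟨x, InnerProductSpace.gramSchmidt ℝ (trivFrame e b x) i⟩ :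
      TotalSpace F E)) e.baseSet := by
  induction i using WellFoundedLT.induction with
  | ind i ih =>
    have hf : ContinuousOn (fun x => (⟨x, trivFrame e b x i⟩ : TotalSpace F E)) e.baseSet := by
      refine (continuousOn_section_iff e continuousOn_id (Set.mapsTo_id _) _).2 ?_
      refine (continuousOn_const (c := b i)).congr fun x hx => ?_
      exact e.continuousLinearMapAt_symmL hx _
    refine (continuousOn_section_iff e continuousOn_id (Set.mapsTo_id _) _).2 ?_
    have h : ∀ x, InnerProductSpace.gramSchmidt ℝ (trivFrame e b x) i =
        trivFrame e b x i - ∑ j ∈ Finset.Iio i,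
          (⟪InnerProductSpace.gramSchmidt ℝ (trivFrame e b x) j, trivFrame e b x i⟫_ℝ /
            ‖InnerProductSpace.gramSchmidt ℝ (trivFrame e b x) j‖ ^ 2) •
          InnerProductSpace.gramSchmidt ℝ (trivFrame e b x) j := fun x =>
      eq_sub_of_add_eq (InnerProductSpace.gramSchmidt_def'' ℝ (trivFrame e b x) i).symm
    simp only [id]
    simp_rw [h, map_sub, map_sum, map_smul]
    refine ((continuousOn_section_iff e continuousOn_id (Set.mapsTo_id _) _).1 hf).sub
      (continuousOn_finsetSum _ fun j hj => ?_)
    have hj' := ih j (Finset.mem_Iio.1 hj)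
    refine ContinuousOn.smul (ContinuousOn.div (hj'.inner_bundle hf) ?_ fun x hx => ?_)
      ((continuousOn_section_iff e continuousOn_id (Set.mapsTo_id _) _).1 hj')
    · simp_rw [← real_inner_self_eq_norm_sq]
      exact hj'.inner_bundle hj'
    · exact pow_ne_zero _ (norm_ne_zero_iff.2
        (InnerProductSpace.gramSchmidt_ne_zero j (linearIndependent_trivFrame e b hx)))

theorem continuousOn_gramSchmidtNormed_trivFrame (i : Fin m) :
    ContinuousOn (fun x => (⟨x, InnerProductSpace.gramSchmidtNormed ℝ (trivFrame e b x) i⟩ :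
      TotalSpace F E)) e.baseSet := by
  have hg := continuousOn_gramSchmidt_trivFrame e b i
  refine (continuousOn_section_iff e continuousOn_id (Set.mapsTo_id _) _).2 ?_
  simp only [id, InnerProductSpace.gramSchmidtNormed, map_smul]
  refine ContinuousOn.smul (ContinuousOn.inv₀ ?_ fun x hx => ?_)
    ((continuousOn_section_iff e continuousOn_id (Set.mapsTo_id _) _).1 hg)
  · simp only [RCLike.ofReal_real_eq_id, id, norm_eq_sqrt_real_inner]
    exact Real.continuous_sqrt.comp_continuousOn (hg.inner_bundle hg)
  · simpa using InnerProductSpace.gramSchmidt_ne_zero i (linearIndependent_trivFrame e b hx)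

variable [∀ x, FiniteDimensional ℝ (E x)]

/-- Near every point the fibres of a Riemannian vector bundle are isometric to the Euclidean space,
continuously in the base point. -/
theorem exists_continuousOn_isometry (b : Module.Basis (Fin m) ℝ F)
    (hm : ∀ x, Module.finrank ℝ (E x) = m) :
    ∃ L : ∀ x, EuclideanSpace ℝ (Fin m) ≃ₗᵢ[ℝ] E x,
      ContinuousOn (fun q : B × EuclideanSpace ℝ (Fin m) => (⟨q.1, L q.1 q.2⟩ : TotalSpace F E))
        (e.baseSet ×ˢ Set.univ) := by
  have hm' : ∀ x, Module.finrank ℝ (E x) = Fintype.card (Fin m) := fun x => by simp [hm x]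
  refine ⟨fun x => (InnerProductSpace.gramSchmidtOrthonormalBasis (hm' x)
    (trivFrame e b x)).repr.symm, ?_⟩
  have hps : Set.MapsTo (Prod.fst : B × EuclideanSpace ℝ (Fin m) → B) (e.baseSet ×ˢ Set.univ)
      e.baseSet := fun q hq => hq.1
  refine (continuousOn_section_iff e continuousOn_fst hps _).2 ?_
  have h1 : ContinuousOn (fun q : B × EuclideanSpace ℝ (Fin m) => ∑ i, q.2 i •
      e.continuousLinearMapAt ℝ q.1
        (InnerProductSpace.gramSchmidtNormed ℝ (trivFrame e b q.1) i))
      (e.baseSet ×ˢ Set.univ) := by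
    refine continuousOn_finsetSum _ fun i _ => ContinuousOn.smul (by fun_prop) ?_
    exact ((continuousOn_section_iff e continuousOn_id (Set.mapsTo_id _) _).1
      (continuousOn_gramSchmidtNormed_trivFrame e b i)).comp continuousOn_fst hps
  refine h1.congr fun q hq => ?_
  rw [← OrthonormalBasis.sum_repr_symm, map_sum]
  refine Finset.sum_congr rfl fun i _ => ?_
  rw [map_smul, InnerProductSpace.gramSchmidtOrthonormalBasis_apply]
  -- The Gram–Schmidt basis agrees with the normalised vectors only where these are nonzero, which
  -- independence guarantees here.
  have := InnerProductSpace.gramSchmidtNormed_unit_length (𝕜 := ℝ) i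
    (linearIndependent_trivFrame e b hq.1)
  rw [← norm_ne_zero_iff, this]
  exact one_ne_zero

variable (F E) in
/-- Integration over the unit spheres of the fibres of a Riemannian vector bundle preserves
continuity. -/
theorem continuous_sphereIntegral [FiniteDimensional ℝ F]
    {Φ : TotalSpace F E → ℝ} (hΦ : ContinuousOn Φ {p | p.2 ≠ 0}) :
    Continuous fun x => sphereIntegral fun v : sphere (0 : E x) 1 => Φ ⟨x, v⟩ := by
  refine continuous_iff_continuousAt.2 fun x₀ => ?_
  set e := trivializationAt F E x₀
  have hx₀ : x₀ ∈ e.baseSet := FiberBundle.mem_baseSet_trivializationAt' x₀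
  refine ContinuousOn.continuousAt ?_ (e.open_baseSet.mem_nhds hx₀)
  have hm : ∀ x, Module.finrank ℝ (E x) = Module.finrank ℝ F := fun x =>
    ((trivializationAt F E x).linearEquivAt ℝ x
      (FiberBundle.mem_baseSet_trivializationAt' x)).finrank_eq
  obtain ⟨L, hL⟩ := exists_continuousOn_isometry e (Module.finBasis ℝ F) hm
  -- All integrals move to one fixed compact sphere, leaving a continuous parameter integral.
  simp_rw [fun x => sphereIntegral_comp_isometry (L x), sphereIntegral_eq]
  refine continuousOn_integral_of_compact_support (k := Set.univ) isCompact_univ ?_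
    fun p x _ hx => absurd (Set.mem_univ x) hx
  have h2 : ContinuousOn (fun q : B × sphere (0 : EuclideanSpace ℝ (Fin (Module.finrank ℝ F))) 1 =>
      (⟨q.1, L q.1 q.2⟩ : TotalSpace F E)) (e.baseSet ×ˢ Set.univ) :=
    hL.comp (f := fun q : B × sphere (0 : EuclideanSpace ℝ (Fin (Module.finrank ℝ F))) 1 =>
      (q.1, (q.2 : EuclideanSpace ℝ (Fin (Module.finrank ℝ F))))) (by fun_prop)
      fun q hq => ⟨hq.1, Set.mem_univ _⟩
  exact hΦ.comp h2 fun q _ => ne_zero_of_mem_unit_sphere (sphereHomeomorph (L q.1) q.2)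

end OrthonormalFrame

/-! ### Derivatives along the fibres, in charts -/

section FibreDerivative

variable {n : ℕ} {M : Type*} [TopologicalSpace M] [ChartedSpace (EuclideanSpace ℝ (Fin n)) M]
  [IsManifold (𝓡 n) ∞ M] [Bundle.RiemannianBundle (fun x : M => TangentSpace (𝓡 n) x)]

/-- The expression of a section over the slit tangent bundle in the preferred chart at `x₀`. -/
def localRep (f : ∀ x : M, sphere (0 : TangentSpace (𝓡 n) x) 1 → TangentSpace (𝓡 n) x) (x₀ : M)
    (q : EuclideanSpace ℝ (Fin n) × EuclideanSpace ℝ (Fin n)) : EuclideanSpace ℝ (Fin n) :=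
  let e := trivializationAt (EuclideanSpace ℝ (Fin n)) (TangentSpace (𝓡 n) (M := M)) x₀
  let x := (chartAt (EuclideanSpace ℝ (Fin n)) x₀).symm q.1
  e.continuousLinearMapAt ℝ x (radialExt (f x) (e.symmL ℝ x q.2))

variable {f : ∀ x : M, sphere (0 : TangentSpace (𝓡 n) x) 1 → TangentSpace (𝓡 n) x}

theorem contDiffOn_localRep (hf : IsSmoothOnSM f) (x₀ : M) :
    ContDiffOn ℝ ∞ (localRep f x₀)
      ((chartAt (EuclideanSpace ℝ (Fin n)) x₀).target ×ˢ {w | w ≠ 0}) := by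
  set e := trivializationAt (EuclideanSpace ℝ (Fin n)) (TangentSpace (𝓡 n) (M := M)) x₀ with he
  set φ := chartAt (EuclideanSpace ℝ (Fin n)) x₀ with hφ
  have hbase : ∀ y ∈ φ.target, φ.symm y ∈ e.baseSet := fun y hy => by
    rw [he, TangentBundle.trivializationAt_baseSet]
    exact φ.map_target hy
  set S : Set (EuclideanSpace ℝ (Fin n) × EuclideanSpace ℝ (Fin n)) := φ.target ×ˢ {w | w ≠ 0}
  have h1 : ContMDiffOn 𝓘(ℝ, EuclideanSpace ℝ (Fin n) × EuclideanSpace ℝ (Fin n))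
      ((𝓡 n).prod 𝓘(ℝ, EuclideanSpace ℝ (Fin n))) ∞ (fun q => (φ.symm q.1, q.2)) S := by
    refine ContMDiffOn.prodMk ?_ contDiff_snd.contMDiff.contMDiffOn
    exact (contMDiffOn_chart_symm (I := 𝓡 n) (n := ∞) (x := x₀)).comp
      contDiff_fst.contMDiff.contMDiffOn fun q hq => hq.1
  have h2 := (e.contMDiffOn_symm (n := ∞) (IB := 𝓡 n)).comp h1
    fun q hq => e.mem_target.2 (hbase _ hq.1)
  have hpt : ∀ q ∈ S, e.toOpenPartialHomeomorph.symm (φ.symm q.1, q.2) =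
      ⟨φ.symm q.1, e.symmL ℝ (φ.symm q.1) q.2⟩ := fun q hq => by
    rw [e.symmL_apply (hbase _ hq.1), e.mk_symm (hbase _ hq.1)]
  have hne : ∀ q ∈ S, e.symmL ℝ (φ.symm q.1) q.2 ≠ 0 := fun q hq h => hq.2 <| by
    have := congrArg (e.continuousLinearMapAt ℝ (φ.symm q.1)) h
    rwa [e.continuousLinearMapAt_symmL (hbase _ hq.1), map_zero] at this
  have h2' : ContMDiffOn 𝓘(ℝ, EuclideanSpace ℝ (Fin n) × EuclideanSpace ℝ (Fin n)) (𝓡 n).tangent ∞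
      (fun q => (⟨φ.symm q.1, e.symmL ℝ (φ.symm q.1) q.2⟩ : TangentBundle (𝓡 n) M)) S :=
    h2.congr fun q hq => (hpt q hq).symm
  have h3 := ContMDiffOn.comp hf h2' fun q hq => hne q hq
  have h4 := contMDiff_snd.comp_contMDiffOn ((e.contMDiffOn (n := ∞) (IB := 𝓡 n)).comp h3
    fun q hq => e.mem_source.2 (hbase _ hq.1))
  rw [← contMDiffOn_iff_contDiffOn]
  refine h4.congr fun q hq => ?_
  simp only [Function.comp_apply]
  rw [localRep, e.continuousLinearMapAt_apply ℝ, e.coe_linearMapAt_of_mem (hbase _ hq.1)]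

/-- A trivialization is linear on fibres, so the fibre derivative is a partial derivative of the
jointly smooth `localRep`, and inherits continuity in the base point. -/
theorem fderiv_radialExt_eq (hf : IsSmoothOnSM f) (x₀ : M) {x : M}
    (hx : x ∈ (chartAt (EuclideanSpace ℝ (Fin n)) x₀).source) {v : TangentSpace (𝓡 n) x}
    (hv : v ≠ 0) (u : TangentSpace (𝓡 n) x) :
    fderiv ℝ (radialExt (f x)) v u =
      (trivializationAt (EuclideanSpace ℝ (Fin n)) (TangentSpace (𝓡 n) (M := M)) x₀).symmL ℝ x
        (fderiv ℝ (localRep f x₀) (chartAt (EuclideanSpace ℝ (Fin n)) x₀ x,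
          (trivializationAt (EuclideanSpace ℝ (Fin n)) (TangentSpace (𝓡 n) (M := M))
            x₀).continuousLinearMapAt ℝ x v)
          (0, (trivializationAt (EuclideanSpace ℝ (Fin n)) (TangentSpace (𝓡 n) (M := M))
            x₀).continuousLinearMapAt ℝ x u)) := by
  set e := trivializationAt (EuclideanSpace ℝ (Fin n)) (TangentSpace (𝓡 n) (M := M)) x₀ with he
  set φ := chartAt (EuclideanSpace ℝ (Fin n)) x₀ with hφ
  have hxe : x ∈ e.baseSet := by
    rw [he, TangentBundle.trivializationAt_baseSet]
    exact hx
  have hne : e.continuousLinearMapAt ℝ x v ≠ 0 := fun h => hv <| by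
    rw [← e.symmL_continuousLinearMapAt (R := ℝ) hxe v, h, map_zero]
  have hmem : (φ x, e.continuousLinearMapAt ℝ x v) ∈
      φ.target ×ˢ {w : EuclideanSpace ℝ (Fin n) | w ≠ 0} := ⟨φ.map_source hx, hne⟩
  have hG : DifferentiableAt ℝ (localRep f x₀) (φ x, e.continuousLinearMapAt ℝ x v) :=
    ((contDiffOn_localRep hf x₀).contDiffAt
      ((φ.open_target.prod isOpen_ne).mem_nhds hmem)).differentiableAt (by simp)
  have h1 : HasFDerivAt (fun w : TangentSpace (𝓡 n) x =>
      ((φ x, e.continuousLinearMapAt ℝ x w) :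
        EuclideanSpace ℝ (Fin n) × EuclideanSpace ℝ (Fin n)))
      ((0 : TangentSpace (𝓡 n) x →L[ℝ] EuclideanSpace ℝ (Fin n)).prod
        (e.continuousLinearMapAt ℝ x)) v :=
    (hasFDerivAt_const _ _).prodMk (e.continuousLinearMapAt ℝ x).hasFDerivAt
  have h2 := (e.symmL ℝ x).hasFDerivAt.comp v (hG.hasFDerivAt.comp v h1)
  have h3 : radialExt (f x) = fun w => e.symmL ℝ x
      (localRep f x₀ (φ x, e.continuousLinearMapAt ℝ x w)) := by
    funext w
    simp only [localRep]
    rw [φ.left_inv hx, e.symmL_continuousLinearMapAt hxe, e.symmL_continuousLinearMapAt hxe]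
  rw [h3, HasFDerivAt.fderiv (f := fun w => e.symmL ℝ x
    (localRep f x₀ (φ x, e.continuousLinearMapAt ℝ x w))) h2]
  rfl

/-- The derivative along the fibres of a smooth section over the slit tangent bundle is
continuous. -/
theorem continuousOn_fderiv_radialExt (hf : IsSmoothOnSM f)
    {u : ∀ p : TangentBundle (𝓡 n) M, TangentSpace (𝓡 n) p.1}
    (hu : ContinuousOn (fun p => (⟨p.1, u p⟩ : TangentBundle (𝓡 n) M)) {p | p.2 ≠ 0}) :
    ContinuousOn (fun p : TangentBundle (𝓡 n) M =>
      (⟨p.1, fderiv ℝ (radialExt (f p.1)) p.2 (u p)⟩ : TangentBundle (𝓡 n) M)) {p | p.2 ≠ 0} := by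
  intro p₀ hp₀
  set x₀ := p₀.1
  set e := trivializationAt (EuclideanSpace ℝ (Fin n)) (TangentSpace (𝓡 n) (M := M)) x₀ with he
  set φ := chartAt (EuclideanSpace ℝ (Fin n)) x₀ with hφ
  set S : Set (TangentBundle (𝓡 n) M) := {p | p.2 ≠ 0} ∩ Bundle.TotalSpace.proj ⁻¹' φ.source
  have hbase : e.baseSet = φ.source := TangentBundle.trivializationAt_baseSet x₀
  have hproj : Continuous (Bundle.TotalSpace.proj : TangentBundle (𝓡 n) M → M) :=
    FiberBundle.continuous_proj _ _
  have hmaps : Set.MapsTo (Bundle.TotalSpace.proj : TangentBundle (𝓡 n) M → M) S e.baseSet :=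
    fun p hp => hbase ▸ hp.2
  suffices h : ContinuousOn (fun p : TangentBundle (𝓡 n) M =>
      (⟨p.1, fderiv ℝ (radialExt (f p.1)) p.2 (u p)⟩ : TangentBundle (𝓡 n) M)) S by
    refine (h p₀ ⟨hp₀, mem_chart_source _ x₀⟩).mono_of_mem_nhdsWithin ?_
    exact Filter.inter_mem self_mem_nhdsWithin
      (mem_nhdsWithin_of_mem_nhds ((φ.open_source.preimage hproj).mem_nhds (mem_chart_source _ x₀)))
  refine (continuousOn_section_iff e hproj.continuousOn hmaps _).2 ?_
  have hv := (continuousOn_section_iff e (S := S) hproj.continuousOn hmaps fun p => p.2).1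
    continuousOn_id
  have hu' := (continuousOn_section_iff e (S := S) hproj.continuousOn hmaps u).1
    (hu.mono Set.inter_subset_left)
  have hd := (contDiffOn_localRep hf x₀).continuousOn_fderiv_of_isOpen
    (φ.open_target.prod isOpen_ne) (by simp)
  have hpair : ContinuousOn (fun p : TangentBundle (𝓡 n) M =>
      (φ p.1, e.continuousLinearMapAt ℝ p.1 p.2)) S :=
    (φ.continuousOn.comp hproj.continuousOn fun p hp => hp.2).prodMk hv
  have hc := (hd.comp hpair fun p hp => ⟨φ.map_source hp.2, fun h => hp.1 <| by
    change e.continuousLinearMapAt ℝ p.1 p.2 = 0 at h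
    rw [← e.symmL_continuousLinearMapAt (R := ℝ) (hmaps hp) p.2, h, map_zero]⟩).clm_apply
    ((continuousOn_const (c := (0 : EuclideanSpace ℝ (Fin n)))).prodMk hu')
  refine hc.congr fun p hp => ?_
  simp only [Function.comp_apply]
  rw [fderiv_radialExt_eq hf x₀ hp.2 hp.1, e.continuousLinearMapAt_symmL (hmaps hp)]

end FibreDerivative

/-! ### Continuity in the base point of the fibre integrals -/

section Integrands

variable {n : ℕ} {M : Type*} [TopologicalSpace M] [ChartedSpace (EuclideanSpace ℝ (Fin n)) M]
  [IsManifold (𝓡 n) ∞ M] [Bundle.RiemannianBundle (fun x : M => TangentSpace (𝓡 n) x)]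
  [IsContinuousRiemannianBundle (EuclideanSpace ℝ (Fin n))
      (fun x : M => TangentSpace (𝓡 n) x)]
  (J : OrthogonalAlmostComplexStructure n M)

theorem continuous_sphereIntegral_of_eqOn {F : ∀ x : M, sphere (0 : TangentSpace (𝓡 n) x) 1 → ℝ}
    {Φ : TangentBundle (𝓡 n) M → ℝ} (hΦ : ContinuousOn Φ {p | p.2 ≠ 0})
    (h : ∀ x v, F x v = Φ ⟨x, v⟩) : Continuous fun x => sphereIntegral (F x) := by
  have := continuous_sphereIntegral (EuclideanSpace ℝ (Fin n))
    (fun x : M => TangentSpace (𝓡 n) x) hΦ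
  convert this using 3 with x
  funext v
  exact h x v

theorem continuousOn_complexStructure_apply {S : Set (TangentBundle (𝓡 n) M)}
    {u : ∀ p : TangentBundle (𝓡 n) M, TangentSpace (𝓡 n) p.1}
    (hu : ContinuousOn (fun p => (⟨p.1, u p⟩ : TangentBundle (𝓡 n) M)) S) :
    ContinuousOn (fun p : TangentBundle (𝓡 n) M =>
      (⟨p.1, J.lin p.1 (u p)⟩ : TangentBundle (𝓡 n) M)) S :=
  ContinuousOn.clm_bundle_apply (F₁ := EuclideanSpace ℝ (Fin n)) (F₂ := EuclideanSpace ℝ (Fin n))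
    (E₁ := fun x : M => TangentSpace (𝓡 n) x) (E₂ := fun x : M => TangentSpace (𝓡 n) x)
    (ϕ := fun p : TangentBundle (𝓡 n) M => J.J p.1)
    (J.smooth.continuous.comp (FiberBundle.continuous_proj _ _)).continuousOn hu

section Tangent

variable {f : ∀ x : M, sphere (0 : TangentSpace (𝓡 n) x) 1 → TangentSpace (𝓡 n) x}

theorem continuous_sphereIntegral_normSq (hf : IsSmoothOnSM f) :
    Continuous fun x => sphereIntegral fun v => ‖f x v‖ ^ 2 := by
  have h := ContinuousOn.inner_bundle (F := EuclideanSpace ℝ (Fin n)) hf.continuousOn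
    hf.continuousOn
  refine continuous_sphereIntegral_of_eqOn h fun x v => ?_
  rw [radialExt_coe, real_inner_self_eq_norm_sq]

theorem continuous_sphereIntegral_iotaV (hf : IsSmoothOnSM f) :
    Continuous fun x => sphereIntegral fun v => ‖iotaV (f x) v‖ ^ 2 := by
  have h := ContinuousOn.inner_bundle (F := EuclideanSpace ℝ (Fin n))
    (v := fun p : TangentBundle (𝓡 n) M => p.2) continuousOn_id hf.continuousOn
  refine continuous_sphereIntegral_of_eqOn (h.norm.pow 2) fun x v => ?_
  simp only [Pi.pow_apply]
  rw [radialExt_coe]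
  rfl

theorem continuous_sphereIntegral_iotaJV (hf : IsSmoothOnSM f) :
    Continuous fun x => sphereIntegral fun v => ‖iotaJV (J.lin x) (f x) v‖ ^ 2 := by
  have h := ContinuousOn.inner_bundle (F := EuclideanSpace ℝ (Fin n))
    (continuousOn_complexStructure_apply J (u := fun p => p.2) continuousOn_id) hf.continuousOn
  refine continuous_sphereIntegral_of_eqOn (h.norm.pow 2) fun x v => ?_
  simp only [Pi.pow_apply]
  rw [radialExt_coe]
  rfl

theorem continuous_sphereIntegral_crossTerm (hf : IsSmoothOnSM f) {d : ℤ}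
    (hd : ∀ x, IsSphericalHarmonic d (f x)) :
    Continuous fun x => sphereIntegral (crossTerm (J.lin x) (f x)) := by
  have hJ := continuousOn_complexStructure_apply J (S := {p | p.2 ≠ 0}) (u := fun p => p.2)
    continuousOn_id
  have h := ContinuousOn.inner_bundle (F := EuclideanSpace ℝ (Fin n))
    (continuousOn_complexStructure_apply J hf.continuousOn) (continuousOn_fderiv_radialExt hf hJ)
  refine continuous_sphereIntegral_of_eqOn h fun x v => ?_
  rw [crossTerm_eq_fderiv_radialExt (J := J.lin x) (J.sq x) (J.inner_map x) (hd x), radialExt_coe]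

end Tangent

section Sym

variable {f : ∀ x : M, sphere (0 : TangentSpace (𝓡 n) x) 1 → symEnd (TangentSpace (𝓡 n) x)}

theorem IsSmoothOnSMSym.continuousOn_apply (hf : IsSmoothOnSMSym f)
    {S : Set (TangentBundle (𝓡 n) M)} (hS : S ⊆ {p | p.2 ≠ 0})
    {u : ∀ p : TangentBundle (𝓡 n) M, TangentSpace (𝓡 n) p.1}
    (hu : ContinuousOn (fun p => (⟨p.1, u p⟩ : TangentBundle (𝓡 n) M)) S) :
    ContinuousOn (fun p : TangentBundle (𝓡 n) M =>
      (⟨p.1, (radialExt (f p.1) p.2).1 (u p)⟩ : TangentBundle (𝓡 n) M)) S :=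
  ContinuousOn.clm_bundle_apply (F₁ := EuclideanSpace ℝ (Fin n)) (F₂ := EuclideanSpace ℝ (Fin n))
    (E₁ := fun x : M => TangentSpace (𝓡 n) x) (E₂ := fun x : M => TangentSpace (𝓡 n) x)
    (hf.continuousOn.mono hS) hu

theorem continuous_sphereIntegral_iotaVSym (hf : IsSmoothOnSMSym f) :
    Continuous fun x => sphereIntegral fun v => ‖iotaVSym (f x) v‖ ^ 2 := by
  have h1 := hf.continuousOn_apply subset_rfl (u := fun p => p.2) continuousOn_id
  have h := ContinuousOn.inner_bundle (F := EuclideanSpace ℝ (Fin n)) h1 h1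
  refine continuous_sphereIntegral_of_eqOn h fun x v => ?_
  rw [radialExt_coe, real_inner_self_eq_norm_sq, iotaVSym]

theorem finrank_tangentSpace (x : M) : Module.finrank ℝ (TangentSpace (𝓡 n) x) = n :=
  finrank_euclideanSpace_fin (𝕜 := ℝ) (n := n)

/-- The squared trace norm is $\sum_i\|f(b_i)\|^2$ for any orthonormal frame, so a continuous local
frame reduces the claim to vectors in $TM$. -/
theorem continuous_sphereIntegral_normSq_sym (hf : IsSmoothOnSMSym f) :
    Continuous fun x => sphereIntegral fun v => ‖f x v‖ ^ 2 := by
  refine continuous_sphereIntegral_of_eqOn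
    (Φ := fun p : TangentBundle (𝓡 n) M => ‖radialExt (f p.1) p.2‖ ^ 2) (fun p₀ hp₀ => ?_)
    fun x v => by rw [radialExt_coe]
  set e := trivializationAt (EuclideanSpace ℝ (Fin n)) (TangentSpace (𝓡 n) (M := M)) p₀.1
  have hproj : Continuous (Bundle.TotalSpace.proj : TangentBundle (𝓡 n) M → M) :=
    FiberBundle.continuous_proj _ _
  obtain ⟨L, hL⟩ := exists_continuousOn_isometry e
    (EuclideanSpace.basisFun (Fin n) ℝ).toBasis finrank_tangentSpace
  set S : Set (TangentBundle (𝓡 n) M) := {p | p.2 ≠ 0} ∩ Bundle.TotalSpace.proj ⁻¹' e.baseSet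
  have hmem : p₀.1 ∈ e.baseSet := FiberBundle.mem_baseSet_trivializationAt' p₀.1
  suffices h : ContinuousOn (fun p : TangentBundle (𝓡 n) M => ‖radialExt (f p.1) p.2‖ ^ 2) S by
    refine (h p₀ ⟨hp₀, hmem⟩).mono_of_mem_nhdsWithin ?_
    exact Filter.inter_mem self_mem_nhdsWithin
      (mem_nhdsWithin_of_mem_nhds ((e.open_baseSet.preimage hproj).mem_nhds hmem))
  have hb : ∀ i, ContinuousOn (fun p : TangentBundle (𝓡 n) M =>
      (⟨p.1, L p.1 (EuclideanSpace.basisFun (Fin n) ℝ i)⟩ : TangentBundle (𝓡 n) M)) S := fun i =>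
    hL.comp (f := fun p : TangentBundle (𝓡 n) M => (p.1, EuclideanSpace.basisFun (Fin n) ℝ i))
      (hproj.continuousOn.prodMk continuousOn_const) fun p hp => ⟨hp.2, Set.mem_univ _⟩
  have h1 := fun i => hf.continuousOn_apply Set.inter_subset_left (hb i)
  refine (continuousOn_finsetSum Finset.univ fun i _ =>
    ContinuousOn.inner_bundle (F := EuclideanSpace ℝ (Fin n)) (h1 i) (h1 i)).congr fun p _ => ?_
  simp only [norm_symEnd_sq ((EuclideanSpace.basisFun (Fin n) ℝ).map (L p.1)),
    OrthonormalBasis.map_apply, real_inner_self_eq_norm_sq]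

end Sym

end Integrands

end

/-! ### Integration of the fibre identities over the manifold -/

theorem lemma4p3 {n : ℕ} {M : Type*} [TopologicalSpace M] [T2Space M] [CompactSpace M]
    [MeasurableSpace M] [BorelSpace M]
    [ChartedSpace (EuclideanSpace ℝ (Fin n)) M] [IsManifold (𝓡 n) ∞ M]
    [Bundle.RiemannianBundle (fun x : M => TangentSpace (𝓡 n) x)]
    [IsContMDiffRiemannianBundle (𝓡 n) ∞ (EuclideanSpace ℝ (Fin n))
      (fun x : M => TangentSpace (𝓡 n) x)]
    (J : OrthogonalAlmostComplexStructure n M) (k : ℕ) :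
    -- (i) the case `E = TM`
    (∀ f : ∀ x : M, sphere (0 : TangentSpace (𝓡 n) x) 1 → TangentSpace (𝓡 n) x,
      IsSmoothOnSM f →
      (∀ x, IsSphericalHarmonic (k : ℤ) (f x)) →
      (∀ x, IsSphericalHarmonic ((k : ℤ) - 1) (iotaV (f x))) →
      (∀ x, IsSphericalHarmonic ((k : ℤ) - 1) (iotaJV (J.lin x) (f x))) →
      integralSM n (fun x : M => curvPairing (hypTensor (J.lin x)) (f x)) =
        (1 / 4 : ℝ) * ((n : ℝ) + 2 * (k : ℝ) - 4) *
          (normSqL2 n (M := M) (W := fun _ => ℝ) (fun x : M => iotaV (f x)) +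
            normSqL2 n (M := M) (W := fun _ => ℝ) (fun x : M => iotaJV (J.lin x) (f x))) +
        (1 / 2 : ℝ) * normSqL2 n f +
        (1 / 2 : ℝ) * integralSM n (fun x : M => crossTerm (J.lin x) (f x))) ∧
    -- (ii) the case `E = S²TM` and `[J, f] = 0`
    (∀ f : ∀ x : M, sphere (0 : TangentSpace (𝓡 n) x) 1 → symEnd (TangentSpace (𝓡 n) x),
      IsSmoothOnSMSym f →
      (∀ x, IsSphericalHarmonic (k : ℤ) (f x)) →
      (∀ x, IsSphericalHarmonic ((k : ℤ) - 1) (iotaVSym (f x))) →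
      (∀ x, IsSphericalHarmonic ((k : ℤ) - 1) (iotaJVSym (J.lin x) (f x))) →
      (∀ x v, J.lin x ∘ₗ (f x v).1 - (f x v).1 ∘ₗ J.lin x = 0) →
      integralSM n (fun x : M => curvPairing (hypTensorSym (J.lin x)) (f x)) =
        ((n : ℝ) + 2 * (k : ℝ) - 4) *
          normSqL2 n (W := fun x => TangentSpace (𝓡 n) x) (fun x : M => iotaVSym (f x)) +
        normSqL2 n f) := by
  have := isContinuousRiemannianBundle_of_isContMDiff (n := n) (M := M)
  have := isFiniteMeasure_riemannianMeasure n M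
  have hint : ∀ {g : M → ℝ}, Continuous g → Integrable g (riemannianMeasure n M) := fun hg =>
    hg.integrable_of_hasCompactSupport (HasCompactSupport.of_compactSpace _)
  refine ⟨fun f hf hk h1 h2 => ?_, fun f hf hk h1 h2 hc => ?_⟩
  · have e : ∀ x, sphereIntegral (curvPairing (hypTensor (J.lin x)) (f x)) = _ := fun x =>
      sphereIntegral_curvPairing_hypTensor (J := J.lin x) (J.sq x) (J.inner_map x) (hk x) (h1 x) (h2 x)
    have i1 := hint (continuous_sphereIntegral_iotaV hf)
    have i2 := hint (continuous_sphereIntegral_iotaJV J hf)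
    have i3 := hint (continuous_sphereIntegral_normSq hf)
    have i4 := hint (continuous_sphereIntegral_crossTerm J hf hk)
    -- The curvature integrand is replaced fibrewise, so only the terms on the right need to be
    -- integrable for the integral over $M$ to split.
    simp only [integralSM, normSqL2, e, finrank_tangentSpace, Int.cast_natCast]
    have i12 := (i1.add i2).const_mul ((1 / 4 : ℝ) * ((n : ℝ) + 2 * (k : ℝ) - 4))
    have i3' := i3.const_mul (1 / 2)
    have i123 := i12.add i3'
    simp only [Pi.add_def] at i12 i123
    rw [integral_add i123 (i4.const_mul _), integral_add i12 i3', integral_const_mul,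
      integral_const_mul, integral_const_mul, integral_add i1 i2]
  · have e : ∀ x, sphereIntegral (curvPairing (hypTensorSym (J.lin x)) (f x)) = _ := fun x =>
      sphereIntegral_curvPairing_hypTensorSym (J := J.lin x) (J.sq x) (J.inner_map x) (hk x) (h1 x) (h2 x) (hc x)
    have i1 := hint (continuous_sphereIntegral_iotaVSym hf)
    have i2 := hint (continuous_sphereIntegral_normSq_sym hf)
    simp only [integralSM, normSqL2, e, finrank_tangentSpace, Int.cast_natCast]
    rw [integral_add (i1.const_mul _) i2, integral_const_mul]
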